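/- Let $k$ be a field of characteristic $0$; complexes are graded cohomologically and $V[1]^n=V^{n+1}$. All graded vector spaces below have zero differential. **Definitions.** Let $V=\bigoplus_n V^n$ be a graded $k$-vector space. A pairing $\omega\colon\Lambda^2V\to k[1]$ is a family of bilinear maps $V^i\times V^j\to k$, zero unless $i+j=-1$, with $\omega(x,y)=-(-1)^{|x||y|}\omega(y,x)$. It is non-degenerate if the induced map $V\to\mathrm{Hom}(V,k[1])$ is an isomorphism, i.e. $V^i\to (V^{-1-i})^*$ is bijective for every $i$. The $1$-shifted Heisenberg Lie algebra is $\mathfrak h=V\oplus k\mathbf c$ with $|\mathbf c|=0$ and with the graded-symmetric bracket of degree $1$ given by $[x+\alpha\mathbf c,\,y+\beta\mathbf c]=(-1)^{|x|}\omega(x,y)\,\mathbf c$ (equivalently, the graded Lie bracket $[sx,sy]=\omega(x,y)\,s\mathbf c$ on $\mathfrak h[-1]$). Its BD-enveloping algebra has underlying complex $\mathrm{Sym}(\mathfrak h)[\hbar]$, with the $k[\hbar]$-linear differential determined by $d(1)=0$, $d(x)=0$ and $d(xa)=(-1)^{|x|}x\,d(a)+\hbar\{x,a\}$ for homogeneous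 $x\in\mathfrak h$, where $\{x,-\}$ is the graded derivation of $\mathrm{Sym}(\mathfrak h)[\hbar]$ extending $[x,-]$. The linear quantization $\mathcal Q(V,\omega)$ is the cochain complex over $k$ obtained from it by setting $\hbar=\mathbf c=1$. For a finite-dimensional vector space $M$ put $\det(M)=\Lambda^{\dim M}M$. **Statement.** (1) Let $V$ be a graded $k$-vector space with $\dim V^n<\infty$ for all $n$ and $V^n=0$ for $|n|\gg0$, and let $\omega\colon\Lambda^2V\to k[1]$ be a non-degenerate pairing. Put $m=\sum_{n\in\mathbb Z}(2n+1)\dim V^{2n+1}$. Then $H^m(\mathcal Q(V,\omega))\cong k$ and $H^d(\mathcal Q(V,\omega))=0$ for $d\neq m$. In other words, there is a quasi-isomorphism $$\det\Big(\bigoplus_nV^{2n+1}\Big)[-m]\;\simeq\;\mathcal Q(V,\omega).$$ (2) Let $W$ be a graded $k$-vector space with $\dim W^n<\infty$ for all $n$ and $W^n=0$ for $|n|\gg0$. Let $T^*[1]W=W\oplus W^*[1]$, where $(W^*[1])^i=(W^{-1-i})^*$, with the pairing $\omega((x,f),(y,h))=h(x)-f(y)$. Put $d_W=\sum_{n\in\mathbb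 Z}(2n+1)\big(\dim W^{2n+1}-\dim W^{2n}\big)$. Then there is a quasi-isomorphism $$\det(W)[-d_W]\;\simeq\;\mathcal Q(T^*[1]W),$$ where $\det(W)=\det\big(\bigoplus_nW^{2n}\big)\otimes\det\big(\bigoplus_nW^{2n+1}\big)^*$ is the determinant line of $W$, placed in degree $0$. -/

import Mathlib

open scoped DirectSum TensorProduct Polynomial ExteriorAlgebra

noncomputable section

namespace BVQuant

universe u v

/-- The Koszul sign `(-1)^n` of an integer `n`, as a scalar. -/
def sgn (k : Type u) [Ring k] (n : ℤ) : k := ((n.negOnePow : ℤˣ) : ℤ)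

theorem sgn_add {k : Type u} [Ring k] (m n : ℤ) : sgn k (m + n) = sgn k m * sgn k n := by
  simp [sgn, Int.negOnePow_add]

theorem sgn_add_mul {k : Type u} [Ring k] (l m n : ℤ) :
    sgn k ((l + m) * n) = sgn k (l * n) * sgn k (m * n) := by
  rw [add_mul, sgn_add]

theorem sgn_mul_add {k : Type u} [Ring k] (l m n : ℤ) :
    sgn k (l * (m + n)) = sgn k (l * m) * sgn k (l * n) := by
  rw [mul_add, sgn_add]

theorem sgn_one {k : Type u} [Ring k] : sgn k 1 = -1 := by
  simp [sgn]

theorem sgn_eq {k : Type u} [Ring k] (n : ℤ) : sgn k n = 1 ∨ sgn k n = -1 := by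
  rcases Int.even_or_odd n with h | h
  · simp [sgn, Int.negOnePow_even n h]
  · simp [sgn, Int.negOnePow_odd n h]

/-! ### The graded-symmetric algebra -/

section GSym

variable (k : Type u) [Field k] (g : ℤ → Type v) [∀ i, AddCommGroup (g i)] [∀ i, Module k (g i)]

/-- The relations `x y = (-1)^{|x||y|} y x` between homogeneous elements of a graded vector
space, imposed on its tensor algebra. -/
inductive SymRel : TensorAlgebra k (⨁ i, g i) → TensorAlgebra k (⨁ i, g i) → Prop
  | comm (i j : ℤ) (x : g i) (y : g j) :
      SymRel
        (TensorAlgebra.ι k (DirectSum.lof k ℤ g i x) * TensorAlgebra.ι k (DirectSum.lof k ℤ g j y))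
        (sgn k (i * j) • (TensorAlgebra.ι k (DirectSum.lof k ℤ g j y) *
          TensorAlgebra.ι k (DirectSum.lof k ℤ g i x)))

/-- The graded-symmetric algebra `Sym(g)` of a graded vector space `g = ⨁ gⁱ`. -/
def GSym : Type (max u v) := RingQuot (SymRel k g)

instance : Ring (GSym k g) := inferInstanceAs (Ring (RingQuot (SymRel k g)))

instance : Algebra k (GSym k g) := inferInstanceAs (Algebra k (RingQuot (SymRel k g)))

/-- The projection from the tensor algebra onto `Sym(g)`. -/
def symMk : TensorAlgebra k (⨁ i, g i) →ₐ[k] GSym k g := RingQuot.mkAlgHom k (SymRel k g)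

theorem symMk_surjective : Function.Surjective (symMk k g) :=
  RingQuot.mkAlgHom_surjective k (SymRel k g)

variable {k g} in
theorem symMk_rel {s t : TensorAlgebra k (⨁ i, g i)} (h : SymRel k g s t) :
    symMk k g s = symMk k g t :=
  RingQuot.mkAlgHom_rel k h

variable {k g} in
/-- The universal property of `Sym(g)` as a quotient of the tensor algebra. -/
def symLift {B : Type*} [Ring B] [Algebra k B] (f : TensorAlgebra k (⨁ i, g i) →ₐ[k] B)
    (h : ∀ s t, SymRel k g s t → f s = f t) : GSym k g →ₐ[k] B :=
  RingQuot.liftAlgHom k ⟨f, fun {s t} => h s t⟩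

variable {k g} in
theorem symLift_symMk {B : Type*} [Ring B] [Algebra k B]
    (f : TensorAlgebra k (⨁ i, g i) →ₐ[k] B) (h : ∀ s t, SymRel k g s t → f s = f t)
    (t : TensorAlgebra k (⨁ i, g i)) : symLift f h (symMk k g t) = f t :=
  RingQuot.liftAlgHom_mkAlgHom_apply k f (fun {s t} => h s t) t

variable {g}

/-- The inclusion of the degree `i` part of `g` into `Sym(g)`. -/
def gen (i : ℤ) : g i →ₗ[k] GSym k g :=
  (symMk k g).toLinearMap ∘ₗ TensorAlgebra.ι k ∘ₗ DirectSum.lof k ℤ g i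

variable {k}

theorem gen_comm {i j : ℤ} (x : g i) (y : g j) :
    gen k i x * gen k j y = sgn k (i * j) • (gen k j y * gen k i x) := by
  have := symMk_rel (SymRel.comm (k := k) i j x y)
  simpa [gen] using this

/-- Induction on `Sym(g)` by multiplication with generators from the left. -/
theorem GSym.induct {P : GSym k g → Prop} (one : P 1)
    (mul : ∀ (i : ℤ) (x : g i) (a : GSym k g), P a → P (gen k i x * a))
    (add : ∀ a b, P a → P b → P (a + b)) (smul : ∀ (c : k) a, P a → P (c • a))
    (a : GSym k g) : P a := by
  obtain ⟨t, rfl⟩ := symMk_surjective k g a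
  suffices h : ∀ b, P b → P (symMk k g t * b) by
    simpa using h 1 one
  have zero : P 0 := by simpa using smul 0 1 one
  induction t using TensorAlgebra.induction with
  | algebraMap r =>
    intro b hb
    rw [AlgHom.commutes, ← Algebra.smul_def]
    exact smul r b hb
  | ι x =>
    intro b hb
    induction x using DirectSum.induction_on with
    | zero => simpa using zero
    | of i x => exact mul i x b hb
    | add x y hx hy =>
      rw [map_add, map_add, add_mul]
      exact add _ _ hx hy
  | mul s t hs ht =>
    intro b hb
    rw [map_mul, mul_assoc]
    exact hs _ (ht _ hb)
  | add s t hs ht =>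
    intro b hb
    rw [map_add, add_mul]
    exact add _ _ (hs _ hb) (ht _ hb)

/-- The operator `(a, e) ↦ (y a, (-1)^{p|y|} y e + L_y(a))` on `Sym(g) × Sym(g)`, for `y` in `gʲ`. -/
def actGen (p : ℤ) (L : ∀ j, g j →ₗ[k] Module.End k (GSym k g)) (j : ℤ) :
    g j →ₗ[k] Module.End k (GSym k g × GSym k g) :=
  LinearMap.mk₂ k
    (fun y ae => (gen k j y * ae.1, sgn k (p * j) • (gen k j y * ae.2) + L j y ae.1))
    (by intros; ext <;> simp [add_mul]; abel)
    (by intro c _ _; ext <;> simp [smul_comm c])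
    (by intros; ext <;> simp [mul_add]; abel)
    (by intro c _ _; ext <;> simp [smul_comm c])

/-- The condition on `L` that makes the recursion of `extend` below compatible with the
graded commutativity of `Sym(g)`. -/
def Compat (p : ℤ) (L : ∀ j, g j →ₗ[k] Module.End k (GSym k g)) : Prop :=
  ∀ (i j : ℤ) (x : g i) (y : g j) (a : GSym k g),
    L i x (gen k j y * a) + sgn k (p * i) • (gen k i x * L j y a) =
      sgn k (i * j) • (L j y (gen k i x * a) + sgn k (p * j) • (gen k j y * L i x a))

/-- The representation of `Sym(g)` on `Sym(g) × Sym(g)` extending `actGen`. -/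
def act (p : ℤ) (L : ∀ j, g j →ₗ[k] Module.End k (GSym k g)) (h : Compat p L) :
    GSym k g →ₐ[k] Module.End k (GSym k g × GSym k g) :=
  symLift (TensorAlgebra.lift k (DirectSum.toModule k ℤ _ (actGen p L))) (by
    rintro _ _ ⟨i, j, x, y⟩
    refine LinearMap.ext fun ⟨a, e⟩ => Prod.ext ?_ ?_
    · simp [actGen, ← mul_assoc, gen_comm x y]
    · have h1 := h i j x y a
      have h2 : gen k i x * (gen k j y * e) = sgn k (i * j) • (gen k j y * (gen k i x * e)) := by
        rw [← mul_assoc, gen_comm x y, smul_mul_assoc, mul_assoc]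
      simp only [map_mul, TensorAlgebra.lift_ι_apply, DirectSum.toModule_lof, map_smul,
        Module.End.mul_apply, LinearMap.smul_apply, actGen, LinearMap.mk₂_apply, mul_add,
        mul_smul_comm, h2, smul_add, Prod.smul_mk] at h1 ⊢
      rw [add_assoc, add_comm (sgn k (p * i) • (gen k i x * L j y a)), h1]
      rw [smul_comm (sgn k (p * i)) (sgn k (p * j)), smul_comm (sgn k (p * i)) (sgn k (i * j)),
        smul_comm (sgn k (p * j)) (sgn k (i * j))]
      abel)

theorem act_gen (p : ℤ) (L : ∀ j, g j →ₗ[k] Module.End k (GSym k g)) (h : Compat p L) (j : ℤ)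
    (y : g j) (ae : GSym k g × GSym k g) :
    act p L h (gen k j y) ae =
      (gen k j y * ae.1, sgn k (p * j) • (gen k j y * ae.2) + L j y ae.1) := by
  have : act p L h (gen k j y) = actGen p L j y := by
    simp [act, gen, symLift_symMk]
  rw [this]
  rfl

/-- The operator `F` on `Sym(g)` with `F(1) = 0` and
`F(y a) = (-1)^{p|y|} y F(a) + L_y(a)` for homogeneous `y` in `g`. -/
def extend (p : ℤ) (L : ∀ j, g j →ₗ[k] Module.End k (GSym k g)) (h : Compat p L) :
    GSym k g →ₗ[k] GSym k g :=
  LinearMap.snd k _ _ ∘ₗ LinearMap.applyₗ (R := k) ((1, 0) : GSym k g × GSym k g) ∘ₗ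
    (act p L h).toLinearMap

theorem extend_one (p : ℤ) (L : ∀ j, g j →ₗ[k] Module.End k (GSym k g)) (h : Compat p L) :
    extend p L h 1 = 0 := by
  simp [extend]

theorem act_fst (p : ℤ) (L : ∀ j, g j →ₗ[k] Module.End k (GSym k g)) (h : Compat p L)
    (a : GSym k g) : (act p L h a (1, 0)).1 = a := by
  induction a using GSym.induct with
  | one => simp
  | mul i x a ha => rw [map_mul, Module.End.mul_apply, act_gen]; simp [ha]
  | add a b ha hb => simp [ha, hb]
  | smul c a ha => simp [ha]

theorem extend_mul (p : ℤ) (L : ∀ j, g j →ₗ[k] Module.End k (GSym k g)) (h : Compat p L) (j : ℤ)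
    (y : g j) (a : GSym k g) :
    extend p L h (gen k j y * a) =
      sgn k (p * j) • (gen k j y * extend p L h a) + L j y a := by
  have := act_fst p L h a
  simp only [extend, LinearMap.comp_apply, AlgHom.toLinearMap_apply, map_mul, LinearMap.applyₗ_apply_apply,
    Module.End.mul_apply, act_gen, this, LinearMap.snd_apply]

variable (k g) in
/-- The part of `Sym(g)` of cohomological degree `d`: the span of all products of homogeneous
elements of `g` whose degrees add up to `d`. -/
def symDeg (d : ℤ) : Submodule k (GSym k g) :=
  Submodule.span k {a | ∃ l : List (Σ i, g i),
    (l.map Sigma.fst).sum = d ∧ a = (l.map fun x => gen k x.1 x.2).prod}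

theorem gen_mul_mem {i d e : ℤ} (x : g i) {a : GSym k g} (ha : a ∈ symDeg k g d) (he : i + d = e) :
    gen k i x * a ∈ symDeg k g e := by
  induction ha using Submodule.span_induction with
  | mem a ha =>
    obtain ⟨l, hl, rfl⟩ := ha
    exact Submodule.subset_span ⟨⟨i, x⟩ :: l, by simp [hl, he], by simp⟩
  | zero => simp
  | add a b _ _ ha hb => rw [mul_add]; exact add_mem ha hb
  | smul c a _ ha => rw [mul_smul_comm]; exact Submodule.smul_mem _ _ ha

end GSym

/-! ### Shifted Lie algebras and the differential of the enveloping algebra -/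

section Lie

variable (k : Type u) [Field k] (g : ℤ → Type v) [∀ i, AddCommGroup (g i)] [∀ i, Module k (g i)]

/-- A `1`-shifted Lie algebra structure on a graded vector space (with zero differential):
a graded-symmetric bracket of degree `1` such that `(s x, s y) ↦ (-1)^{|x|} s [x, y]` is a graded
Lie bracket on the shift `s g = g[-1]`; the Jacobi identity is written out in terms of `[x, y]`. -/
structure ShiftedLie where
  bracket : ∀ i j, g i →ₗ[k] g j →ₗ[k] g (i + j + 1)
  symm : ∀ (i j : ℤ) (x : g i) (y : g j),
    DirectSum.lof k ℤ g _ (bracket i j x y) =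
      sgn k (i * j) • DirectSum.lof k ℤ g _ (bracket j i y x)
  jacobi : ∀ (i j l : ℤ) (x : g i) (y : g j) (z : g l),
    DirectSum.lof k ℤ g _ (bracket _ l (bracket i j x y) z) +
      sgn k i • DirectSum.lof k ℤ g _ (bracket i _ x (bracket j l y z)) +
      sgn k ((i + 1) * j) • DirectSum.lof k ℤ g _ (bracket j _ y (bracket i l x z)) = 0

namespace ShiftedLie

variable {k g} (A : ShiftedLie k g)

/-- The bracket of two homogeneous elements of `g`, as an element of `Sym(g)`. -/
def br (i j : ℤ) (x : g i) (y : g j) : GSym k g := gen k (i + j + 1) (A.bracket i j x y)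

/-- The operator `y ↦ (a ↦ [x, y] a)`. -/
def brL (i : ℤ) (x : g i) (j : ℤ) : g j →ₗ[k] Module.End k (GSym k g) :=
  LinearMap.mul k (GSym k g) ∘ₗ gen k (i + j + 1) ∘ₗ A.bracket i j x

theorem br_symm {i j : ℤ} (x : g i) (y : g j) : A.br i j x y = sgn k (i * j) • A.br j i y x := by
  have := congrArg (fun t => symMk k g (TensorAlgebra.ι k t)) (A.symm i j x y)
  simpa [br, gen] using this

theorem br_jacobi {i j l : ℤ} (x : g i) (y : g j) (z : g l) :
    A.br _ l (A.bracket i j x y) z + sgn k i • A.br i _ x (A.bracket j l y z) +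
      sgn k ((i + 1) * j) • A.br j _ y (A.bracket i l x z) = 0 := by
  have := congrArg (fun t => symMk k g (TensorAlgebra.ι k t))
    (A.jacobi i j l x y z)
  simpa [br, gen] using this

theorem brL_compat (i : ℤ) (x : g i) : Compat (i + 1) (A.brL i x) := by
  intro j l y z a
  have h1 := gen_comm (k := k) (A.bracket i j x y) z
  have h2 := gen_comm (k := k) (A.bracket i l x z) y
  simp only [brL, LinearMap.comp_apply, LinearMap.mul_apply', ← mul_assoc, h1, h2]
  simp only [sgn_add_mul, one_mul, mul_comm l j]
  rcases sgn_eq (k := k) (i * j) with h3 | h3 <;> rcases sgn_eq (k := k) (i * l) with h4 | h4 <;>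
    rcases sgn_eq (k := k) (j * l) with h5 | h5 <;> rcases sgn_eq (k := k) j with h6 | h6 <;>
    rcases sgn_eq (k := k) l with h7 | h7 <;>
    simp only [h3, h4, h5, h6, h7, mul_one, mul_neg, neg_neg, one_smul, neg_smul, smul_add,
      neg_mul] <;> abel

/-- The Poisson bracket `{x, -}` on `Sym(g)` with a homogeneous `x` in `g`: the graded derivation
of degree `|x| + 1` that extends `[x, -]`. -/
def ad (i : ℤ) (x : g i) : GSym k g →ₗ[k] GSym k g := extend (i + 1) (A.brL i x) (A.brL_compat i x)

theorem ad_one (i : ℤ) (x : g i) : A.ad i x 1 = 0 := extend_one _ _ _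

theorem ad_mul {i j : ℤ} (x : g i) (y : g j) (a : GSym k g) :
    A.ad i x (gen k j y * a) =
      A.br i j x y * a + sgn k ((i + 1) * j) • (gen k j y * A.ad i x a) := by
  rw [ad, extend_mul, add_comm]
  rfl

/-- `x ↦ {x, -}` as a linear map. -/
def adL (i : ℤ) : g i →ₗ[k] Module.End k (GSym k g) where
  toFun := A.ad i
  map_add' x y := by
    ext a
    induction a using GSym.induct with
    | one => simp [ad_one]
    | mul j z a ha =>
      simp only [LinearMap.add_apply] at ha ⊢
      simp only [ad_mul, ha, br, map_add, LinearMap.add_apply, mul_add, add_mul, smul_add]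
      abel
    | add a b ha hb => simp only [map_add, ha, hb]
    | smul c a ha => simp only [map_smul, ha]
  map_smul' c x := by
    ext a
    induction a using GSym.induct with
    | one => simp [ad_one]
    | mul j z a ha =>
      simp only [LinearMap.smul_apply, RingHom.id_apply] at ha ⊢
      simp only [ad_mul, ha, br, map_smul, LinearMap.smul_apply, smul_add, smul_mul_assoc,
        mul_smul_comm, smul_comm c]
    | add a b ha hb => simp only [map_add, ha, hb]
    | smul c a ha => simp only [map_smul, ha]

theorem adL_compat : Compat 1 A.adL := by
  intro i j x y a
  change A.ad i x _ + _ • (_ * A.ad j y a) = _ • (A.ad j y _ + _ • (_ * A.ad i x a))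
  rw [ad_mul, ad_mul, br_symm A x y]
  simp only [sgn_add_mul, one_mul, mul_comm j i]
  rcases sgn_eq (k := k) (i * j) with h3 | h3 <;> rcases sgn_eq (k := k) i with h4 | h4 <;>
    rcases sgn_eq (k := k) j with h5 | h5 <;>
    simp only [h3, h4, h5, mul_one, mul_neg, neg_neg, one_smul, neg_smul, smul_add,
      neg_mul] <;> abel

/-- The second-order operator `Δ` on `Sym(g)` given by `Δ(1) = 0` and
`Δ(x a) = (-1)^{|x|} x Δ(a) + {x, a}` for homogeneous `x` in `g`. Thus `Δ(x) = 0` and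
`Δ(x y) = [x, y]` for `x` and `y` in `g`. -/
def bv : GSym k g →ₗ[k] GSym k g := extend 1 A.adL A.adL_compat

theorem bv_one : A.bv 1 = 0 := extend_one _ _ _

theorem bv_mul {i : ℤ} (x : g i) (a : GSym k g) :
    A.bv (gen k i x * a) = sgn k i • (gen k i x * A.bv a) + A.ad i x a := by
  rw [bv, extend_mul, one_mul]
  rfl

theorem bv_gen {i : ℤ} (x : g i) : A.bv (gen k i x) = 0 := by
  simpa [bv_one, ad_one] using A.bv_mul x 1

theorem bv_gen_mul_gen {i j : ℤ} (x : g i) (y : g j) :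
    A.bv (gen k i x * gen k j y) = gen k _ (A.bracket i j x y) := by
  have := A.ad_mul x y 1
  rw [bv_mul, bv_gen]
  simpa [ad_one, br] using this

theorem ad_jacobi {i j : ℤ} (x : g i) (y : g j) (a : GSym k g) :
    A.ad _ (A.bracket i j x y) a + sgn k i • A.ad i x (A.ad j y a) +
      sgn k ((i + 1) * j) • A.ad j y (A.ad i x a) = 0 := by
  induction a using GSym.induct with
  | one => simp [ad_one]
  | mul l z a ha =>
    have h1 := congrArg (· * a) (A.br_jacobi x y z)
    have h2 := congrArg (gen k l z * ·) ha
    have e1 (b : GSym k g) : A.ad i x (A.br j l y z * b) = _ := A.ad_mul x (A.bracket j l y z) b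
    have e2 (b : GSym k g) : A.ad j y (A.br i l x z * b) = _ := A.ad_mul y (A.bracket i l x z) b
    simp only [ad_mul, map_add, map_smul, e1, e2]
    change _ + _ • (_ + _ • (A.br j l y z * _) + _) + _ • (_ + _ • (A.br i l x z * _) + _) = _
    simp only [sgn_add_mul, sgn_mul_add, sgn_add, sgn_one, one_mul, mul_one, mul_comm j i]
      at h1 h2 ⊢
    rcases sgn_eq (k := k) (i * j) with h3 | h3 <;> rcases sgn_eq (k := k) (i * l) with h4 | h4 <;>
      rcases sgn_eq (k := k) (j * l) with h5 | h5 <;> rcases sgn_eq (k := k) i with h6 | h6 <;>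
      rcases sgn_eq (k := k) j with h7 | h7 <;> rcases sgn_eq (k := k) l with h8 | h8 <;>
      simp only [h3, h4, h5, h6, h7, h8, mul_one, mul_neg, neg_neg, one_smul, neg_smul, smul_add,
        add_mul, mul_add, neg_mul, zero_mul, mul_zero] at h1 h2 ⊢ <;>
      first
      | linear_combination (norm := abel1) h1 + h2
      | linear_combination (norm := abel1) h1 - h2
  | add a b ha hb =>
    simp only [map_add, smul_add]
    linear_combination (norm := abel) ha + hb
  | smul c a ha =>
    simp only [map_smul, smul_comm _ c, ← smul_add, ha, smul_zero]

theorem bv_ad {i : ℤ} (x : g i) (a : GSym k g) :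
    A.bv (A.ad i x a) = -(sgn k i • A.ad i x (A.bv a)) := by
  induction a using GSym.induct with
  | one => simp [ad_one, bv_one]
  | mul j y b hb =>
    have h1 := A.ad_jacobi x y b
    have h2 := congrArg (gen k j y * ·) hb
    have e1 : A.bv (A.br i j x y * b) = _ := A.bv_mul (A.bracket i j x y) b
    simp only [ad_mul, bv_mul, map_add, map_smul, e1]
    change _ • (A.br i j x y * _) + _ + _ = _
    simp only [sgn_add_mul, sgn_add, sgn_one, one_mul, mul_one] at h1 h2 ⊢
    rcases sgn_eq (k := k) (i * j) with h3 | h3 <;> rcases sgn_eq (k := k) i with h6 | h6 <;>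
      rcases sgn_eq (k := k) j with h7 | h7 <;>
      simp only [h3, h6, h7, mul_one, mul_neg, neg_neg, one_smul, neg_smul, smul_add,
        neg_add, one_mul, neg_mul] at h1 h2 ⊢ <;>
      first
      | linear_combination (norm := abel1) h1 + h2
      | linear_combination (norm := abel1) h1 - h2
  | add a b ha hb => simp only [map_add, ha, hb, smul_add, neg_add]
  | smul c a ha => simp only [map_smul, ha, smul_neg, smul_comm c]

theorem bv_bv (a : GSym k g) : A.bv (A.bv a) = 0 := by
  induction a using GSym.induct with
  | one => simp [bv_one]
  | mul i x a ha =>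
    simp only [bv_mul, map_add, map_smul, ha, bv_ad, mul_zero, smul_zero, zero_add]
    abel
  | add a b ha hb => simp only [map_add, ha, hb, add_zero]
  | smul c a ha => simp only [map_smul, ha, smul_zero]

theorem symDeg_induct {d : ℤ} {P : ℤ → GSym k g → Prop} (one : P 0 1)
    (mul : ∀ (d i : ℤ) (x : g i) (a : GSym k g), a ∈ symDeg k g d → P d a →
      P (i + d) (gen k i x * a))
    (zero : P d 0) (add : ∀ a b, P d a → P d b → P d (a + b))
    (smul : ∀ (c : k) a, P d a → P d (c • a)) {a : GSym k g} (ha : a ∈ symDeg k g d) : P d a := by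
  induction ha using Submodule.span_induction with
  | mem a ha =>
    obtain ⟨l, rfl, rfl⟩ := ha
    clear zero add smul
    induction l with
    | nil => simpa using one
    | cons x l ih =>
      simpa using mul _ x.1 x.2 _ (Submodule.subset_span ⟨l, rfl, rfl⟩) ih
  | zero => exact zero
  | add a b _ _ ha hb => exact add _ _ ha hb
  | smul c a _ ha => exact smul c a ha

theorem ad_mem {i d e : ℤ} (x : g i) {a : GSym k g} (ha : a ∈ symDeg k g d) (he : i + d + 1 = e) :
    A.ad i x a ∈ symDeg k g e := by
  subst he
  refine symDeg_induct (P := fun d a => A.ad i x a ∈ symDeg k g (i + d + 1)) ?_ ?_ ?_ ?_ ?_ ha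
  · simp [ad_one]
  · intro d j y b hb h
    rw [ad_mul]
    exact add_mem (gen_mul_mem _ hb (by ring))
      (Submodule.smul_mem _ _ (gen_mul_mem y h (by ring)))
  · simp
  · intro a b ha hb
    rw [map_add]
    exact add_mem ha hb
  · intro c a ha
    rw [map_smul]
    exact Submodule.smul_mem _ _ ha

theorem bv_mem {d : ℤ} {a : GSym k g} (ha : a ∈ symDeg k g d) : A.bv a ∈ symDeg k g (d + 1) := by
  refine symDeg_induct (P := fun d a => A.bv a ∈ symDeg k g (d + 1)) ?_ ?_ ?_ ?_ ?_ ha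
  · simp [bv_one]
  · intro d j y b hb h
    rw [bv_mul]
    exact add_mem (Submodule.smul_mem _ _ (gen_mul_mem y h (by ring))) (A.ad_mem y hb rfl)
  · simp
  · intro a b ha hb
    rw [map_add]
    exact add_mem ha hb
  · intro c a ha
    rw [map_smul]
    exact Submodule.smul_mem _ _ ha

/-- The operator `Δ` from degree `d` to degree `d + 1`. -/
def bvDeg (d : ℤ) : symDeg k g d →ₗ[k] symDeg k g (d + 1) :=
  A.bv.restrict fun _ ha => A.bv_mem ha

/-- The differential `ħ Δ` on `Sym(g)[ħ]`, from degree `d` to degree `d + 1`. -/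
def bdDiff (d : ℤ) : k[X] ⊗[k] symDeg k g d →ₗ[k[X]] k[X] ⊗[k] symDeg k g (d + 1) :=
  (Polynomial.X : k[X]) • (A.bvDeg d).baseChange k[X]

theorem bdDiff_bdDiff (d : ℤ) : A.bdDiff (d + 1) ∘ₗ A.bdDiff d = 0 := by
  have : A.bvDeg (d + 1) ∘ₗ A.bvDeg d = 0 :=
    LinearMap.ext fun a => Subtype.ext (A.bv_bv a)
  rw [bdDiff, bdDiff, LinearMap.comp_smul, LinearMap.smul_comp, ← LinearMap.baseChange_comp, this]
  simp

/-- The cochain complex over `k[ħ]` underlying the BD-enveloping algebra of `g ⊗ k[ħ]`: the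
graded module `Sym_{k[ħ]}(g ⊗ k[ħ]) = k[ħ] ⊗ Sym(g)` with the differential `ħ Δ`, so that
`d(1) = 0`, `d(x) = 0` and `d(x a) = (-1)^{|x|} x d(a) + ħ {x, a}` for homogeneous `x` in `g`.
The variable of `k[X]` plays the role of `ħ`. -/
def bdComplex : CochainComplex (ModuleCat.{max u v} k[X]) ℤ :=
  CochainComplex.of (fun d => ModuleCat.of k[X] (k[X] ⊗[k] symDeg k g d))
    (fun d => ModuleCat.ofHom (A.bdDiff d))
    (fun d => by rw [← ModuleCat.ofHom_comp, bdDiff_bdDiff]; rfl)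

end ShiftedLie
end Lie

/-! ### Quadratic spaces, Heisenberg algebras and linear quantization -/

section Quad

variable (k : Type u) [Field k] (V : ℤ → Type v) [∀ i, AddCommGroup (V i)] [∀ i, Module k (V i)]

/-- A graded-skew-symmetric pairing `Λ² V → k[1]`, given by its components
`Vⁱ × Vʲ → k[1]^{i+j}`. The graded vector space `k[1]` is `k` in degree `-1`. -/
structure ShiftedPairing where
  form : ∀ i j, V i →ₗ[k] V j →ₗ[k] k
  degree : ∀ i j : ℤ, i + j ≠ -1 → form i j = 0
  skew : ∀ (i j : ℤ) (x : V i) (y : V j), form i j x y = -(sgn k (i * j) * form j i y x)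

/-- The degree `i` part of the graded vector space `k c` with `c` in degree `0`. -/
def centre (i : ℤ) : Submodule k k where
  carrier := {a | i ≠ 0 → a = 0}
  add_mem' ha hb h := by simp [ha h, hb h]
  zero_mem' _ := rfl
  smul_mem' c a ha h := by simp [ha h]

/-- The graded vector space `V ⊕ k c` underlying the Heisenberg algebra. -/
abbrev HeisSpace (i : ℤ) : Type (max u v) := V i × centre k i

namespace ShiftedPairing

variable {k V} (ω : ShiftedPairing k V)

/-- The pairing is non-degenerate: the induced map `V → Hom(V, k[1])` is an isomorphism in every
degree. -/
def Nondegenerate : Prop := ∀ i : ℤ, Function.Bijective (ω.form i (-1 - i))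

theorem form_mem (i j : ℤ) (x : V i) (y : V j) : ω.form i j x y ∈ centre k (i + j + 1) := by
  intro h
  rw [ω.degree i j (by omega)]
  rfl

theorem lof_centre {i j : ℤ} (h : i = j) (a : k) (hi : a ∈ centre k i) (hj : a ∈ centre k j) :
    DirectSum.lof k ℤ (HeisSpace k V) i (0, ⟨a, hi⟩) =
      DirectSum.lof k ℤ (HeisSpace k V) j (0, ⟨a, hj⟩) := by
  subst h
  rfl

theorem sgn_form (i j : ℤ) (x : V i) (y : V j) :
    sgn k i * ω.form i j x y = sgn k (i * j) * (sgn k j * ω.form j i y x) := by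
  by_cases h : i + j = -1
  · have h1 : sgn k i * sgn k j = -1 := by rw [← sgn_add, h]; simp [sgn]
    have h2 : sgn k i = -sgn k j := by
      rcases sgn_eq (k := k) j with h5 | h5 <;> rw [h5] at h1 ⊢
      · linear_combination h1
      · linear_combination -h1
    rw [ω.skew i j x y, h2]
    ring
  · rw [ω.degree i j h, ω.degree j i (by omega)]
    simp

/-- The `1`-shifted Heisenberg Lie algebra `V ⊕ k c`, with
`[x + α c, y + β c] = (-1)^{|x|} ω(x, y) c`. The sign turns the graded-skew-symmetric `ω` into a
graded-symmetric map of degree `1`; equivalently, the corresponding graded Lie bracket on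
`(V ⊕ k c)[-1]` is `[s x, s y] = ω(x, y) s c`. -/
def heis : ShiftedLie k (HeisSpace k V) where
  bracket i j := LinearMap.mk₂ k
    (fun x y => (0, sgn k i • (⟨ω.form i j x.1 y.1, ω.form_mem i j x.1 y.1⟩ : centre k (i + j + 1))))
    (by intros; ext <;> simp [mul_add])
    (by intros; ext <;> simp [mul_left_comm])
    (by intros; ext <;> simp [mul_add])
    (by intros; ext <;> simp [mul_left_comm])
  symm i j x y := by
    simp only [LinearMap.mk₂_apply]
    rw [← map_smul, Prod.smul_mk, smul_zero]
    refine (lof_centre (V := V) (show i + j + 1 = j + i + 1 by ring) _ _ ?_).trans ?_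
    · have := (sgn k i • (⟨ω.form i j x.1 y.1, ω.form_mem i j x.1 y.1⟩ : centre k (i + j + 1))).2
      exact fun h => this (by omega)
    · congr 3
      exact ω.sgn_form i j x.1 y.1
  jacobi i j l x y z := by
    have h0 (m : ℤ) (h : (0 : k) ∈ centre k m) : (⟨0, h⟩ : centre k m) = 0 := rfl
    simp only [LinearMap.mk₂_apply, map_zero, LinearMap.zero_apply, h0, smul_zero]
    simp only [Prod.mk_zero_zero, map_zero, smul_zero, add_zero]

/-- The central element `c`, as an element of `Sym(V ⊕ k c)`. -/
def c : GSym k (HeisSpace k V) := gen k 0 ((0, ⟨1, fun h => absurd rfl h⟩) : HeisSpace k V 0)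

theorem c_mul_mem {d : ℤ} {a : GSym k (HeisSpace k V)} (ha : a ∈ symDeg k (HeisSpace k V) d) :
    c * a ∈ symDeg k (HeisSpace k V) d :=
  gen_mul_mem _ ha (zero_add d)

theorem bv_c_mul (a : GSym k (HeisSpace k V)) : ω.heis.bv (c * a) = c * ω.heis.bv a := by
  have h : ω.heis.adL 0 ((0, ⟨1, fun h => absurd rfl h⟩) : HeisSpace k V 0) = 0 := by
    refine LinearMap.ext fun b => ?_
    change ω.heis.ad 0 _ b = 0
    induction b using GSym.induct with
    | one => rw [ShiftedLie.ad_one]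
    | mul j y b hb =>
      rw [ShiftedLie.ad_mul, hb, mul_zero, smul_zero, add_zero]
      have : ω.heis.bracket 0 j ((0, ⟨1, fun h => absurd rfl h⟩) : HeisSpace k V 0) y = 0 := by
        ext <;> simp [heis]
      rw [ShiftedLie.br, this, map_zero, zero_mul]
    | add a b ha hb => rw [map_add, ha, hb, add_zero]
    | smul r a ha => rw [map_smul, ha, smul_zero]
  have h2 := LinearMap.congr_fun h a
  change ω.heis.ad 0 _ a = 0 at h2
  rw [c, ShiftedLie.bv_mul, h2, add_zero]
  simp [sgn]

/-- Multiplication with `c` on the degree `d` part of `Sym(V ⊕ k c)`. -/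
def cMul (d : ℤ) : symDeg k (HeisSpace k V) d →ₗ[k] symDeg k (HeisSpace k V) d :=
  (LinearMap.mulLeft k c).restrict fun _ ha => c_mul_mem ha

variable (k V) in
/-- The submodule `(ħ - 1) M + (c - 1) M` of the degree `d` part `M` of `Sym(V ⊕ k c)[ħ]`. -/
def evalSub (d : ℤ) : Submodule k[X] (k[X] ⊗[k] symDeg k (HeisSpace k V) d) :=
  LinearMap.range
      ((Polynomial.X - 1 : k[X]) •
        (LinearMap.id : k[X] ⊗[k] symDeg k (HeisSpace k V) d →ₗ[k[X]] _)) ⊔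
    LinearMap.range ((cMul d - LinearMap.id).baseChange k[X])

theorem evalSub_le (d : ℤ) : evalSub k V d ≤ (evalSub k V (d + 1)).comap (ω.heis.bdDiff d) := by
  refine sup_le ?_ ?_
  · rintro _ ⟨m, rfl⟩
    refine Submodule.mem_sup_left ⟨ω.heis.bdDiff d m, ?_⟩
    simp
  · rintro _ ⟨m, rfl⟩
    refine Submodule.mem_sup_right ⟨ω.heis.bdDiff d m, ?_⟩
    have : ω.heis.bvDeg d ∘ₗ (cMul d - LinearMap.id) =
        (cMul (d + 1) - LinearMap.id) ∘ₗ ω.heis.bvDeg d := by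
      refine LinearMap.ext fun a => Subtype.ext ?_
      have := ω.bv_c_mul (a : GSym k (HeisSpace k V))
      change ω.heis.bv (c * a.1 - a.1) = c * ω.heis.bv a.1 - ω.heis.bv a.1
      rw [map_sub, this]
    have h2 := congrArg (fun f => (f.baseChange k[X]) m) this
    simp only [LinearMap.baseChange_comp, LinearMap.comp_apply] at h2
    simp only [ShiftedLie.bdDiff, LinearMap.smul_apply, map_smul, h2]

/-- The degree `d` part of the linear quantization: `Sym(V ⊕ k c)[ħ]` in degree `d`, with `ħ` and
`c` both set to `1`. -/
abbrev QuantDeg (_ω : ShiftedPairing k V) (d : ℤ) : Type (max u v) :=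
  (k[X] ⊗[k] symDeg k (HeisSpace k V) d) ⧸ evalSub k V d

/-- The differential of the linear quantization, induced by the one of the BD-enveloping algebra. -/
def quantDiff (d : ℤ) : ω.QuantDeg d →ₗ[k] ω.QuantDeg (d + 1) :=
  ((evalSub k V d).mapQ (evalSub k V (d + 1)) (ω.heis.bdDiff d) (ω.evalSub_le d)).restrictScalars k

theorem quantDiff_quantDiff (d : ℤ) : ω.quantDiff (d + 1) ∘ₗ ω.quantDiff d = 0 := by
  refine LinearMap.ext fun a => ?_
  obtain ⟨a, rfl⟩ := Submodule.Quotient.mk_surjective _ a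
  have := LinearMap.congr_fun (ω.heis.bdDiff_bdDiff d) a
  simp only [LinearMap.comp_apply, LinearMap.zero_apply] at this
  simp [quantDiff, this]

/-- The linear quantization `Q(V, ω)`: the cochain complex over `k` obtained from the
BD-enveloping algebra of the `1`-shifted Heisenberg Lie algebra of `(V, ω)` by setting
`ħ = c = 1`. -/
def quantization : CochainComplex (ModuleCat.{max u v} k) ℤ :=
  CochainComplex.of (fun d => ModuleCat.of k (ω.QuantDeg d))
    (fun d => ModuleCat.ofHom (ω.quantDiff d))
    (fun d => by rw [← ModuleCat.ofHom_comp, quantDiff_quantDiff]; rfl)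

end ShiftedPairing

/-- The shifted cotangent space `T^*[1]V = V ⊕ V^*[1]`; the degree `i` part of `V^*[1]` is the
dual of `V^{-1-i}`. -/
abbrev Cotangent (i : ℤ) : Type (max u v) := V i × Module.Dual k (V (-1 - i))

/-- The pairing on `T^*[1]V` obtained by skew-symmetrizing the evaluation pairing:
`ω((x, f), (y, h)) = h(x) - f(y)`, where a functional on one graded piece of `V` is extended by
zero to the other graded pieces. -/
def cotangentPairing : ShiftedPairing k (Cotangent k V) where
  form i j := LinearMap.mk₂ k
    (fun x y => y.2 (DirectSum.component k ℤ V (-1 - j) (DirectSum.lof k ℤ V i x.1)) -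
      x.2 (DirectSum.component k ℤ V (-1 - i) (DirectSum.lof k ℤ V j y.1)))
    (by intros; simp; ring)
    (by intros; simp [mul_sub])
    (by intros; simp; ring)
    (by intros; simp [mul_sub])
  degree i j h := by
    ext x y <;> simp [DirectSum.component.of, show i ≠ -1 - j by omega, show j ≠ -1 - i by omega]
  skew i j x y := by
    by_cases h : i + j = -1
    · have : sgn k (i * j) = 1 := by
        have he : Even (i * j) := by
          obtain rfl : j = -1 - i := by omega
          rcases Int.even_or_odd i with h | h <;> simp [h, parity_simps]
        simp [sgn, Int.negOnePow_even _ he]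
      simp [this]
    · simp [DirectSum.component.of, show i ≠ -1 - j by omega, show j ≠ -1 - i by omega]

/-- The determinant line `Λ^{dim M} M` of a finite-dimensional vector space. -/
abbrev DetLine (M : Type v) [AddCommGroup M] [Module k M] : Type (max u v) :=
  ⋀[k]^(Module.finrank k M) M

/-- The total space of the odd-degree part of a graded vector space. -/
abbrev OddPart : Type v := ⨁ n : ℤ, V (2 * n + 1)

/-- The total space of the even-degree part of a graded vector space. -/
abbrev EvenPart : Type v := ⨁ n : ℤ, V (2 * n)

/-- The determinant line of a bounded, degreewise finite-dimensional graded vector space, the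
tensor product of the lines `det(Vⁿ)^{⊗ (-1)^n}`: the determinant of the even part tensored with
the dual of the determinant of the odd part. -/
abbrev GradedDet : Type (max u v) :=
  DetLine k (EvenPart V) ⊗[k] Module.Dual k (DetLine k (OddPart V))

end Quad
end BVQuant
end

/-!
Let `(V, ω)` be a non-degenerate graded space. The pairing has degree `1`, so it pairs even vectors
with odd ones, and a homogeneous basis `ξ_a` of the odd part together with the dual basis `x_a` of
the even part is a Darboux basis (`Nondegenerate.exists_darbouxBasis`). In these coordinates the
linear quantization is `k[x_1, …, x_n] ⊗ Λ[ξ_1, …, ξ_n]` with the BV operator `∑ ∂/∂x_a ∂/∂ξ_a`.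

The multiplication by the element `∑ x_a ξ_a` of degree `-1` serves as a homotopy. Its
anticommutator with the differential is the weight operator (`DarbouxBasis.weightOp`), and a
monomial with `p` even and `q` odd letters is an eigenvector with the eigenvalue `n + p - q`
(`DarbouxBasis.bv_bivector_mul_word`). The operator is null-homotopic, so it vanishes on cohomology,
and only the weight zero contributes (`DarbouxBasis.mem_range_of_mem_nonzeroWeight`); this uses
that the nonzero integers are invertible in `k`. A nonzero monomial has `q ≤ n`, so weight zero
forces `p = 0` and `q = n`: up to a scalar only the product `ξ_1 ⋯ ξ_n` is left
(`DarbouxBasis.word_of_weight_eq_zero`), and its degree is the sum of the degrees of the `ξ_a`. It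
is a cocycle, and it is not a coboundary, because all weights in the degree below are nonzero and
it does not vanish in the linear quantization: the algebra map to the exterior algebra of the odd
part that sends `c` to `1` detects it (`DarbouxBasis.toExt_top_ne_zero`).

Hence the cohomology is a line in one degree. A determinant line is a line too
(`finrank_detLine`), and a map that sends a generator to the class of `ξ_1 ⋯ ξ_n` is a
quasi-isomorphism (`exists_quasiIso_from_single`). The pairing of a shifted cotangent space is
non-degenerate (`cotangentPairing_nondegenerate`), which gives the second assertion after a
reindexing of the dimensions (`finsum_cotangent`).
-/

noncomputable section

namespace BVQuant

/-! ### Maps out of a complex concentrated in one degree -/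

section Homology

open CategoryTheory

variable {R : Type*} [Ring R]

/-- A map from `L` to the middle term of a short complex of modules that takes values in the
cycles, is injective modulo boundaries and meets every homology class induces an isomorphism from
`L` to the homology. -/
theorem isIso_liftCycles_homologyπ (S : ShortComplex (ModuleCat R)) {L : ModuleCat R}
    (φ : L ⟶ S.X₂) (hφ : φ ≫ S.g = 0)
    (hinj : ∀ x, φ.hom x ∈ LinearMap.range S.f.hom → x = 0)
    (hsurj : ∀ z, S.g.hom z = 0 → ∃ x, z - φ.hom x ∈ LinearMap.range S.f.hom) :
    IsIso (S.liftCycles φ hφ ≫ S.homologyπ) := by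
  have key : (S.liftCycles φ hφ ≫ S.homologyπ) ≫ S.moduleCatHomologyIso.hom =
      S.moduleCatLeftHomologyData.liftK φ hφ ≫ S.moduleCatLeftHomologyData.π := by
    rw [Category.assoc, ShortComplex.π_moduleCatCyclesIso_hom, ← Category.assoc]
    congr 1
    rw [← cancel_mono S.moduleCatLeftHomologyData.i]
    simp
  have mem (w : LinearMap.ker S.g.hom) : w ∈ LinearMap.range S.moduleCatToCycles ↔
      (w : S.X₂) ∈ LinearMap.range S.f.hom :=
    ⟨fun ⟨y, hy⟩ => ⟨y, congrArg Subtype.val hy⟩, fun ⟨y, hy⟩ => ⟨y, Subtype.ext hy⟩⟩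
  have bij : Function.Bijective (S.moduleCatLeftHomologyData.liftK φ hφ ≫
      S.moduleCatLeftHomologyData.π).hom := by
    constructor
    · refine (injective_iff_map_eq_zero _).2 fun x hx => hinj x ?_
      exact (mem ⟨φ.hom x, congr($hφ x)⟩).1 ((Submodule.Quotient.mk_eq_zero _).1 hx)
    · intro w
      obtain ⟨⟨z, hz⟩, rfl⟩ := Submodule.Quotient.mk_surjective _ w
      obtain ⟨x, hx⟩ := hsurj z hz
      refine ⟨x, ((Submodule.Quotient.eq _).2 ?_).symm⟩
      exact (mem (⟨z, hz⟩ - ⟨φ.hom x, congr($hφ x)⟩)).2 hx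
  rw [← key] at bij
  have h := (ConcreteCategory.isIso_iff_bijective
    ((S.liftCycles φ hφ ≫ S.homologyπ) ≫ S.moduleCatHomologyIso.hom)).2 bij
  exact IsIso.of_isIso_comp_right _ S.moduleCatHomologyIso.hom

open HomologicalComplex in
/-- A complex of modules that is exact outside degree `m` receives a quasi-isomorphism from any
module `L` placed in degree `m` that maps to the cycles and represents each homology class in degree
`m` exactly once. -/
theorem exists_quasiIso_from_single (K : CochainComplex (ModuleCat R) ℤ) {l m : ℤ}
    (hl : l + 1 = m) (L : ModuleCat R) (hK : ∀ d, d ≠ m → K.ExactAt d)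
    (φ : L ⟶ K.X m) (hφ : φ ≫ K.d m (m + 1) = 0)
    (hinj : ∀ x, φ.hom x ∈ LinearMap.range (K.d l m).hom → x = 0)
    (hsurj : ∀ z, (K.d m (m + 1)).hom z = 0 →
      ∃ x, z - φ.hom x ∈ LinearMap.range (K.d l m).hom) :
    Nonempty (L ≅ K.homology m) ∧
      ∃ f : (single (ModuleCat R) (ComplexShape.up ℤ) m).obj L ⟶ K, QuasiIso f := by
  have hprev : (ComplexShape.up ℤ).prev m = l := by simp [← hl]
  have hnext : (ComplexShape.up ℤ).next m = m + 1 := by simp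
  have hφ' : φ ≫ (K.sc m).g = 0 := by
    change φ ≫ K.d m _ = 0
    rw [hnext, hφ]
  have hrange : LinearMap.range (K.sc m).f.hom = LinearMap.range (K.d l m).hom := by
    change LinearMap.range (K.d ((ComplexShape.up ℤ).prev m) m).hom = _
    rw [hprev]
  have iso : IsIso ((K.sc m).liftCycles φ hφ' ≫ (K.sc m).homologyπ) := by
    refine isIso_liftCycles_homologyπ (K.sc m) φ hφ' ?_ ?_
    · rw [hrange]
      exact hinj
    · rw [hrange]
      intro z hz
      refine hsurj z ?_
      change (K.d m ((ComplexShape.up ℤ).next m)).hom z = 0 at hz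
      rwa [hnext] at hz
  refine ⟨⟨@asIso _ _ _ _ _ iso⟩, mkHomFromSingle φ ?_, ?_⟩
  · rintro d rfl
    exact hφ
  · rw [quasiIso_iff]
    intro d
    by_cases hd : d = m
    · obtain rfl := hd
      rw [quasiIsoAt_iff_isIso_homologyMap]
      set f := mkHomFromSingle (K := K) (c := ComplexShape.up ℤ) φ
        (by rintro e rfl; exact hφ) with hf
      have h : (singleObjHomologySelfIso (ComplexShape.up ℤ) d L).inv ≫ homologyMap f d =
          (K.sc d).liftCycles φ hφ' ≫ (K.sc d).homologyπ := by
        rw [← singleObjCyclesSelfIso_inv_homologyπ, Category.assoc, homologyπ_naturality,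
          ← Category.assoc]
        congr 1
        refine (cancel_mono (K.iCycles d)).1
          (Eq.trans ?_ ((K.sc d).liftCycles_i φ hφ').symm)
        change ((singleObjCyclesSelfIso (ComplexShape.up ℤ) d L).inv ≫ cyclesMap f d) ≫
          K.iCycles d = φ
        rw [Category.assoc, cyclesMap_i, ← Category.assoc, singleObjCyclesSelfIso_inv_iCycles,
          hf, mkHomFromSingle_f]
        simp
      rw [← h] at iso
      exact @IsIso.of_isIso_comp_left _ _ _ _ _
        (singleObjHomologySelfIso (ComplexShape.up ℤ) d L).inv _ _ iso
    · rw [quasiIsoAt_iff_exactAt _ _ (exactAt_single_obj (ComplexShape.up ℤ) m L d hd)]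
      exact hK d hd

end Homology

/-! ### Eigenspaces and invariant subspaces -/

/-- On the quotient by an invariant subspace `B` that contains `f z`, the image of `z` lies both in
the kernel of `f` and in the sum of the other eigenspaces, so it vanishes. -/
theorem mem_of_map_mem_of_mem_iSup_eigenspace {k Q : Type*} [Field k] [AddCommGroup Q] [Module k Q]
    (f : Module.End k Q) {B : Submodule k Q} (hB : B ≤ B.comap f) {z : Q} (hz : f z ∈ B)
    (hw : z ∈ ⨆ w : k, ⨆ (_ : w ≠ 0), f.eigenspace w) : z ∈ B := by
  have h0 : B.mkQ z ∈ Module.End.eigenspace (B.mapQ B f hB) 0 := by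
    simpa [Module.End.mem_eigenspace_iff] using hz
  have h1 : B.mkQ z ∈ ⨆ w : k, ⨆ (_ : w ≠ 0), Module.End.eigenspace (B.mapQ B f hB) w := by
    have := Submodule.mem_map_of_mem (f := B.mkQ) hw
    simp only [Submodule.map_iSup] at this
    refine SetLike.le_def.1 (iSup₂_mono fun w _ => ?_) this
    rintro _ ⟨y, hy, rfl⟩
    rw [SetLike.mem_coe, Module.End.mem_eigenspace_iff] at hy
    simp [hy]
  have h2 := (Submodule.disjoint_def.1
    (Module.End.eigenspaces_iSupIndep (B.mapQ B f hB) 0)) _ h0 h1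
  simpa using h2

/-! ### The BV operator on the symmetric algebra of a Heisenberg algebra -/

universe u v

section Quad

variable {k : Type u} [Field k] {V : ℤ → Type v} [∀ i, AddCommGroup (V i)] [∀ i, Module k (V i)]

theorem sgn_even {n : ℤ} (h : Even n) : sgn k n = 1 := by
  simp [sgn, Int.negOnePow_even n h]

theorem sgn_odd {n : ℤ} (h : Odd n) : sgn k n = -1 := by
  simp [sgn, Int.negOnePow_odd n h]

variable (k) in
/-- The inclusion of `Vⁱ` into `Sym(V ⊕ k c)`. -/
def vec (i : ℤ) : V i →ₗ[k] GSym k (HeisSpace k V) := gen k i ∘ₗ LinearMap.inl k _ _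

theorem vec_comm {i j : ℤ} (x : V i) (y : V j) :
    vec k i x * vec k j y = sgn k (i * j) • (vec k j y * vec k i x) :=
  gen_comm _ _

/-- A vector of odd degree squares to zero, as `2` is invertible. -/
theorem vec_mul_self [CharZero k] {i : ℤ} (hi : Odd i) (x : V i) : vec k i x * vec k i x = 0 := by
  have h := vec_comm (k := k) x x
  rw [sgn_odd (hi.mul hi), neg_one_smul, eq_neg_iff_add_eq_zero, ← two_smul k] at h
  exact (smul_eq_zero.1 h).resolve_left two_ne_zero

/-- The image of a linear combination in `⨁ i, V i` in `Sym(V ⊕ k c)`. -/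
theorem toModule_vec_lof (i : ℤ) (x : V i) :
    DirectSum.toModule k ℤ _ (vec k (V := V)) (DirectSum.lof k ℤ V i x) = vec k i x := by
  simp

namespace ShiftedPairing

theorem c_mul_comm (a : GSym k (HeisSpace k V)) : c * a = a * c := by
  induction a using GSym.induct with
  | one => simp
  | mul i x a ha =>
    have h : c * gen k i x = gen k i x * c := by
      rw [c, gen_comm]
      simp [sgn]
    rw [← mul_assoc, h, mul_assoc, ha, mul_assoc]
  | add a b ha hb => rw [mul_add, ha, hb, add_mul]
  | smul r a ha => rw [mul_smul_comm, ha, smul_mul_assoc]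

theorem gen_centre {i : ℤ} (a : k) (ha : a ∈ centre k i) :
    gen k i ((0, ⟨a, ha⟩) : HeisSpace k V i) = a • c := by
  by_cases hi : i = 0
  · subst hi
    rw [c, ← map_smul]
    congr 1
    ext <;> simp
  · obtain rfl : a = 0 := ha hi
    rw [zero_smul, ← map_zero (gen k i)]
    rfl

theorem gen_eq {i : ℤ} (x : HeisSpace k V i) : gen k i x = vec k i x.1 + (x.2 : k) • c := by
  rw [← gen_centre x.2.1 x.2.2, vec, LinearMap.comp_apply, ← map_add]
  simp

variable (ω : ShiftedPairing k V)

theorem br_heis {i j : ℤ} (x : HeisSpace k V i) (y : HeisSpace k V j) :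
    ω.heis.br i j x y = (sgn k i * ω.form i j x.1 y.1) • c :=
  gen_centre _ _

/-- The Poisson bracket `{x, -}` with a vector `x` of degree `i`. -/
abbrev adVec (i : ℤ) (x : V i) : GSym k (HeisSpace k V) →ₗ[k] GSym k (HeisSpace k V) :=
  ω.heis.ad i ((x, 0) : HeisSpace k V i)

theorem adVec_vec_mul {i j : ℤ} (x : V i) (y : V j) (a : GSym k (HeisSpace k V)) :
    ω.adVec i x (vec k j y * a) =
      (sgn k i * ω.form i j x y) • (c * a) + sgn k ((i + 1) * j) • (vec k j y * ω.adVec i x a) := by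
  have h := ω.heis.ad_mul ((x, 0) : HeisSpace k V i) ((y, 0) : HeisSpace k V j) a
  rw [br_heis, smul_mul_assoc] at h
  exact h

theorem bv_vec_mul {i : ℤ} (x : V i) (a : GSym k (HeisSpace k V)) :
    ω.heis.bv (vec k i x * a) = sgn k i • (vec k i x * ω.heis.bv a) + ω.adVec i x a :=
  ω.heis.bv_mul _ _

/-- The operator `x {ξ, -} - ξ {x, -}`. For `x` even and `ξ` odd it is an even derivation. -/
def rot {i j : ℤ} (x : V i) (ξ : V j) : GSym k (HeisSpace k V) →ₗ[k] GSym k (HeisSpace k V) :=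
  LinearMap.mulLeft k (vec k i x) ∘ₗ ω.adVec j ξ - LinearMap.mulLeft k (vec k j ξ) ∘ₗ ω.adVec i x

theorem rot_apply {i j : ℤ} (x : V i) (ξ : V j) (a : GSym k (HeisSpace k V)) :
    ω.rot x ξ a = vec k i x * ω.adVec j ξ a - vec k j ξ * ω.adVec i x a := rfl

theorem rot_one {i j : ℤ} (x : V i) (ξ : V j) : ω.rot x ξ 1 = 0 := by
  simp [rot_apply, ShiftedLie.ad_one]

/-- The anticommutator of the BV operator with the multiplication by `x ξ` is of first order. -/
theorem bv_vec_mul_vec_mul {i j : ℤ} (hi : Even i) (hj : Odd j) (x : V i) (ξ : V j)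
    (a : GSym k (HeisSpace k V)) :
    ω.heis.bv (vec k i x * vec k j ξ * a) + vec k i x * vec k j ξ * ω.heis.bv a =
      ω.form i j x ξ • (c * a) + ω.rot x ξ a := by
  rw [mul_assoc, mul_assoc, bv_vec_mul, bv_vec_mul, adVec_vec_mul, rot_apply, sgn_even hi,
    sgn_odd hj, sgn_odd (hi.add_one.mul hj)]
  simp only [mul_add, one_smul, neg_smul, mul_neg, one_mul]
  abel

theorem rot_vec_mul {i j l : ℤ} (hi : Even i) (hj : Odd j) (x : V i) (ξ : V j) (y : V l)
    (a : GSym k (HeisSpace k V)) :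
    ω.rot x ξ (vec k l y * a) = vec k l y * ω.rot x ξ a -
      c * ((ω.form j l ξ y • vec k i x + ω.form i l x y • vec k j ξ) * a) := by
  have h1 : vec k i x * (vec k l y * ω.adVec j ξ a) = vec k l y * (vec k i x * ω.adVec j ξ a) := by
    rw [← mul_assoc, vec_comm, sgn_even (hi.mul_right l), one_smul, mul_assoc]
  have h2 : sgn k ((i + 1) * l) • (vec k j ξ * (vec k l y * ω.adVec i x a)) =
      vec k l y * (vec k j ξ * ω.adVec i x a) := by
    rw [← mul_assoc, vec_comm, smul_mul_assoc, smul_smul, ← sgn_add_mul,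
      sgn_even ((hi.add_one.add_odd hj).mul_right l), one_smul, mul_assoc]
  have hc (b d : GSym k (HeisSpace k V)) : b * (c * d) = c * (b * d) := by
    rw [← mul_assoc, ← c_mul_comm, mul_assoc]
  rw [rot_apply, rot_apply, adVec_vec_mul, adVec_vec_mul, sgn_even (hj.add_one.mul_right l),
    sgn_even hi, sgn_odd hj]
  generalize sgn k ((i + 1) * l) = s at h2 ⊢
  simp only [mul_add, mul_sub, mul_smul_comm, add_mul, smul_mul_assoc, h1, h2, hc, one_smul,
    one_mul, neg_mul, neg_smul, mul_neg]
  abel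

/-! ### Darboux bases -/

/-- A Darboux basis of a non-degenerate graded space: a homogeneous basis `ξ` of the odd part,
with the dual basis `x` of the even part. That the families span is expressed by the expansions of
homogeneous vectors in them; as `ω(ξ_a, x_b) = -δ_ab`, the expansion of an even vector carries a
sign. -/
structure DarbouxBasis (n : ℕ) where
  deg : Fin n → ℤ
  odd_deg : ∀ a, Odd (deg a)
  ξ : ∀ a, V (deg a)
  x : ∀ a, V (-1 - deg a)
  form_x_ξ : ∀ a b, ω.form _ _ (x a) (ξ b) = if a = b then 1 else 0
  sum_even : ∀ (i : ℤ) (y : V i), Even i →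
    ∑ a, ω.form _ i (ξ a) y • DirectSum.lof k ℤ V _ (x a) = -DirectSum.lof k ℤ V i y
  sum_odd : ∀ (i : ℤ) (y : V i), Odd i →
    ∑ a, ω.form _ i (x a) y • DirectSum.lof k ℤ V _ (ξ a) = DirectSum.lof k ℤ V i y

namespace DarbouxBasis

variable {ω} {n : ℕ} (b : ω.DarbouxBasis n)

theorem even_deg (a : Fin n) : Even (-1 - b.deg a) := odd_neg_one.sub_odd (b.odd_deg a)

theorem sum_even_vec {i : ℤ} (hi : Even i) (y : V i) :
    ∑ a, ω.form _ i (b.ξ a) y • vec k _ (b.x a) = -vec k i y := by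
  have h := congrArg (DirectSum.toModule k ℤ _ (vec k (V := V))) (b.sum_even i y hi)
  simpa only [map_sum, map_smul, map_neg, toModule_vec_lof] using h

theorem sum_odd_vec {i : ℤ} (hi : Odd i) (y : V i) :
    ∑ a, ω.form _ i (b.x a) y • vec k _ (b.ξ a) = vec k i y := by
  have h := congrArg (DirectSum.toModule k ℤ _ (vec k (V := V))) (b.sum_odd i y hi)
  simpa only [map_sum, map_smul, toModule_vec_lof] using h

/-- The element `∑ x_a ξ_a` of `Sym(V ⊕ k c)`, of degree `-1`; it is inverse to the pairing. -/
def bivector : GSym k (HeisSpace k V) := ∑ a, vec k _ (b.x a) * vec k _ (b.ξ a)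

/-- The derivation of `Sym(V ⊕ k c)` with `y ↦ c y` for even and `y ↦ -c y` for odd vectors `y`. -/
def euler : GSym k (HeisSpace k V) →ₗ[k] GSym k (HeisSpace k V) := ∑ a, ω.rot (b.x a) (b.ξ a)

/-- The anticommutator of the BV operator with the multiplication by `∑ x_a ξ_a`. -/
theorem bv_bivector_mul (s : GSym k (HeisSpace k V)) :
    ω.heis.bv (b.bivector * s) + b.bivector * ω.heis.bv s = (n : k) • (c * s) + b.euler s := by
  simp only [bivector, Finset.sum_mul, map_sum, ← Finset.sum_add_distrib,
    bv_vec_mul_vec_mul ω (b.even_deg _) (b.odd_deg _), b.form_x_ξ, if_true, one_smul]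
  rw [Finset.sum_add_distrib, euler, LinearMap.sum_apply]
  simp [Nat.cast_smul_eq_nsmul]

theorem form_odd_odd {i j : ℤ} (hi : Odd i) (hj : Odd j) (x : V i) (y : V j) :
    ω.form i j x y = 0 := by
  rw [ω.degree i j fun h => absurd (hi.add_odd hj) (by rw [h]; decide)]
  rfl

theorem form_even_even {i j : ℤ} (hi : Even i) (hj : Even j) (x : V i) (y : V j) :
    ω.form i j x y = 0 := by
  rw [ω.degree i j fun h => absurd (hi.add hj) (by rw [h]; decide)]
  rfl

theorem euler_vec_mul {l : ℤ} (y : V l) (s : GSym k (HeisSpace k V)) :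
    b.euler (vec k l y * s) = vec k l y * b.euler s - c * ((∑ a, (ω.form _ l (b.ξ a) y •
      vec k _ (b.x a) + ω.form _ l (b.x a) y • vec k _ (b.ξ a))) * s) := by
  simp only [euler, LinearMap.sum_apply, rot_vec_mul ω (b.even_deg _) (b.odd_deg _),
    Finset.sum_sub_distrib, Finset.mul_sum, Finset.sum_mul]

theorem euler_even_mul {l : ℤ} (hl : Even l) (y : V l) (s : GSym k (HeisSpace k V)) :
    b.euler (vec k l y * s) = vec k l y * b.euler s + c * (vec k l y * s) := by
  simp only [euler_vec_mul, form_even_even (b.even_deg _) hl, zero_smul, add_zero,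
    b.sum_even_vec hl, neg_mul, mul_neg, sub_neg_eq_add]

theorem euler_odd_mul {l : ℤ} (hl : Odd l) (y : V l) (s : GSym k (HeisSpace k V)) :
    b.euler (vec k l y * s) = vec k l y * b.euler s - c * (vec k l y * s) := by
  simp only [euler_vec_mul, form_odd_odd (b.odd_deg _) hl, zero_smul, zero_add,
    b.sum_odd_vec hl]

/-! ### Monomials -/

/-- The monomial with the even letters `e` and the odd letters `ξ_a`, for `a` in `o`. -/
def word (e : List (Σ i : {i : ℤ // Even i}, V i)) (o : List (Fin n)) :
    GSym k (HeisSpace k V) :=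
  (e.map fun y => vec k _ y.2).prod * (o.map fun a => vec k _ (b.ξ a)).prod

/-- The cohomological degree of a monomial. -/
def wordDeg (e : List (Σ i : {i : ℤ // Even i}, V i)) (o : List (Fin n)) : ℤ :=
  (e.map fun y => y.1.1).sum + (o.map b.deg).sum

theorem word_cons_left (y : Σ i : {i : ℤ // Even i}, V i)
    (e : List (Σ i : {i : ℤ // Even i}, V i)) (o : List (Fin n)) :
    b.word (y :: e) o = vec k _ y.2 * b.word e o := by
  simp [word, mul_assoc]

theorem word_cons_right (e : List (Σ i : {i : ℤ // Even i}, V i)) (a : Fin n) (o : List (Fin n)) :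
    b.word e (a :: o) = vec k _ (b.ξ a) * b.word e o := by
  induction e with
  | nil => simp [word]
  | cons y e ih =>
    rw [word_cons_left, ih, word_cons_left, ← mul_assoc, ← mul_assoc, vec_comm,
      sgn_even (y.1.2.mul_right _), one_smul]

theorem wordDeg_cons_left (y : Σ i : {i : ℤ // Even i}, V i)
    (e : List (Σ i : {i : ℤ // Even i}, V i)) (o : List (Fin n)) :
    b.wordDeg (y :: e) o = y.1.1 + b.wordDeg e o := by
  simp [wordDeg, add_assoc]

theorem wordDeg_cons_right (e : List (Σ i : {i : ℤ // Even i}, V i)) (a : Fin n)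
    (o : List (Fin n)) : b.wordDeg e (a :: o) = b.deg a + b.wordDeg e o := by
  simp [wordDeg, add_left_comm]

theorem vec_mul_mem {i d : ℤ} (x : V i) {s : GSym k (HeisSpace k V)}
    (hs : s ∈ symDeg k (HeisSpace k V) d) : vec k i x * s ∈ symDeg k (HeisSpace k V) (i + d) :=
  gen_mul_mem _ hs rfl

theorem one_mem_symDeg : (1 : GSym k (HeisSpace k V)) ∈ symDeg k (HeisSpace k V) 0 :=
  Submodule.subset_span ⟨[], by simp⟩

theorem word_mem (e : List (Σ i : {i : ℤ // Even i}, V i)) (o : List (Fin n)) :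
    b.word e o ∈ symDeg k (HeisSpace k V) (b.wordDeg e o) := by
  induction e with
  | nil =>
    induction o with
    | nil => simpa [word, wordDeg] using one_mem_symDeg
    | cons a o ih => rw [word_cons_right, wordDeg_cons_right]; exact vec_mul_mem _ ih
  | cons y e ih => rw [word_cons_left, wordDeg_cons_left]; exact vec_mul_mem _ ih

theorem euler_word (e : List (Σ i : {i : ℤ // Even i}, V i)) (o : List (Fin n)) :
    b.euler (b.word e o) = ((e.length : k) - o.length) • (c * b.word e o) := by
  have hc {i : ℤ} (y : V i) (s : GSym k (HeisSpace k V)) :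
      vec k i y * (c * s) = c * (vec k i y * s) := by
    rw [← mul_assoc, ← c_mul_comm, mul_assoc]
  induction e with
  | nil =>
    induction o with
    | nil => simp [word, euler, rot_one]
    | cons a o ih =>
      rw [word_cons_right, euler_odd_mul _ (b.odd_deg a), ih, mul_smul_comm, hc, List.length_cons,
        Nat.cast_succ]
      module
  | cons y e ih =>
    rw [word_cons_left, euler_even_mul _ y.1.2, ih, mul_smul_comm, hc, List.length_cons,
      Nat.cast_succ]
    module

/-- Monomials are eigenvectors, modulo `c - 1`, of the anticommutator of the BV operator with the
multiplication by `∑ x_a ξ_a`. -/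
theorem bv_bivector_mul_word (e : List (Σ i : {i : ℤ // Even i}, V i)) (o : List (Fin n)) :
    ω.heis.bv (b.bivector * b.word e o) + b.bivector * ω.heis.bv (b.word e o) =
      (((n + e.length - o.length : ℤ) : k)) • (c * b.word e o) := by
  rw [bv_bivector_mul, euler_word, ← add_smul]
  congr 1
  push_cast
  ring

/-- Permuting the odd letters changes a monomial by a sign. -/
theorem prod_perm {o o' : List (Fin n)} (h : o.Perm o') :
    ∃ t : k, (o.map fun a => vec k _ (b.ξ a)).prod =
      t • (o'.map fun a => vec k _ (b.ξ a)).prod := by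
  induction h with
  | nil => exact ⟨1, by simp⟩
  | cons a _ ih =>
    obtain ⟨t, ht⟩ := ih
    exact ⟨t, by simp [ht]⟩
  | swap a a' o =>
    refine ⟨sgn k (b.deg a' * b.deg a), ?_⟩
    simp only [List.map_cons, List.prod_cons, ← mul_assoc]
    rw [vec_comm, smul_mul_assoc]
  | trans _ _ ih ih' =>
    obtain ⟨t, ht⟩ := ih
    obtain ⟨t', ht'⟩ := ih'
    exact ⟨t * t', by rw [ht, ht', smul_smul]⟩

/-- A monomial in which some `ξ_a` is repeated vanishes. -/
theorem word_eq_zero [CharZero k] (e : List (Σ i : {i : ℤ // Even i}, V i)) {o : List (Fin n)}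
    (ho : ¬ o.Nodup) : b.word e o = 0 := by
  obtain ⟨a, ha⟩ := List.exists_duplicate_iff_not_nodup.2 ho
  obtain ⟨o', ho'⟩ := (List.duplicate_iff_sublist.1 ha).exists_perm_append
  obtain ⟨t, ht⟩ := b.prod_perm ho'
  rw [word, ht]
  simp [← mul_assoc _ _ (List.prod _), vec_mul_self (b.odd_deg a)]

/-- The product of all the odd basis vectors. -/
def top : GSym k (HeisSpace k V) := b.word [] (List.finRange n)

/-- A nonzero monomial of weight zero has no even letters and contains each odd basis vector
once. -/
theorem word_of_weight_eq_zero [CharZero k] (e : List (Σ i : {i : ℤ // Even i}, V i))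
    (o : List (Fin n)) (h : (n + e.length - o.length : ℤ) = 0) :
    b.word e o = 0 ∨ (b.wordDeg e o = ∑ a, b.deg a ∧ ∃ t : k, b.word e o = t • b.top) := by
  by_cases ho : o.Nodup
  · right
    have h1 : o.length ≤ n := by simpa using ho.length_le_card
    obtain rfl : e = [] := List.eq_nil_of_length_eq_zero (by omega)
    have hp : o.Perm (List.finRange n) := by
      refine (List.perm_of_nodup_nodup_toFinset_eq ho (List.nodup_finRange n) ?_)
      rw [List.toFinset_finRange, ← Finset.card_eq_iff_eq_univ, List.toFinset_card_of_nodup ho]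
      simp only [List.length_nil, Fintype.card_fin] at h ⊢
      omega
    refine ⟨?_, ?_⟩
    · rw [wordDeg, (hp.map b.deg).sum_eq]
      rw [← List.ofFn_eq_map, List.sum_ofFn]
      simp
    · obtain ⟨t, ht⟩ := b.prod_perm hp
      exact ⟨t, by simp [top, word, ht]⟩
  · exact Or.inl (b.word_eq_zero e ho)

end DarbouxBasis
end ShiftedPairing
end Quad

section Quad

variable {k : Type u} [Field k] {V : ℤ → Type v} [∀ i, AddCommGroup (V i)] [∀ i, Module k (V i)]

namespace ShiftedPairing

variable {ω : ShiftedPairing k V}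

namespace DarbouxBasis

variable {n : ℕ} (b : ω.DarbouxBasis n)

/-! ### The top monomial -/

/-- The map from `V ⊕ k c` to the exterior algebra that sends `ξ_a` to the `a`-th basis vector,
the even part of `V` to zero and `c` to `1`. -/
def extGen (i : ℤ) : HeisSpace k V i →ₗ[k] ExteriorAlgebra k (Fin n → k) :=
  (ExteriorAlgebra.ι k ∘ₗ LinearMap.pi fun a => ω.form _ i (b.x a)) ∘ₗ LinearMap.fst k _ _ +
    Algebra.linearMap k _ ∘ₗ (centre k i).subtype ∘ₗ LinearMap.snd k _ _

theorem extGen_apply (i : ℤ) (y : HeisSpace k V i) :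
    b.extGen i y = ExteriorAlgebra.ι k (fun a => ω.form _ i (b.x a) y.1) +
      algebraMap k _ (y.2 : k) := rfl

theorem extGen_even {i : ℤ} (hi : Even i) (y : HeisSpace k V i) :
    b.extGen i y = algebraMap k _ (y.2 : k) := by
  have : (fun a => ω.form _ i (b.x a) y.1) = 0 :=
    funext fun a => form_even_even (b.even_deg a) hi _ _
  rw [extGen_apply, this, map_zero, zero_add]

theorem extGen_odd {i : ℤ} (hi : Odd i) (y : HeisSpace k V i) :
    b.extGen i y = ExteriorAlgebra.ι k (fun a => ω.form _ i (b.x a) y.1) := by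
  have : (y.2 : k) = 0 := y.2.2 (by rintro rfl; exact absurd hi (by decide))
  rw [extGen_apply, this, map_zero, add_zero]

theorem extGen_comm {i j : ℤ} (x : HeisSpace k V i) (y : HeisSpace k V j) :
    b.extGen i x * b.extGen j y = sgn k (i * j) • (b.extGen j y * b.extGen i x) := by
  rcases Int.even_or_odd i with hi | hi
  · rw [sgn_even (hi.mul_right j), one_smul, b.extGen_even hi, Algebra.commutes]
  rcases Int.even_or_odd j with hj | hj
  · rw [sgn_even (hj.mul_left i), one_smul, b.extGen_even hj, Algebra.commutes]
  · rw [sgn_odd (hi.mul hj), b.extGen_odd hi, b.extGen_odd hj, neg_one_smul,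
      eq_neg_iff_add_eq_zero, ExteriorAlgebra.ι_add_mul_swap]

/-- The algebra map from `Sym(V ⊕ k c)` to the exterior algebra of the odd part of `V` that kills
the even part of `V` and sends `c` to `1`. -/
def toExt : GSym k (HeisSpace k V) →ₐ[k] ExteriorAlgebra k (Fin n → k) :=
  symLift (TensorAlgebra.lift k (DirectSum.toModule k ℤ _ b.extGen)) (by
    rintro _ _ ⟨i, j, x, y⟩
    simpa using b.extGen_comm x y)

theorem toExt_gen (i : ℤ) (y : HeisSpace k V i) : b.toExt (gen k i y) = b.extGen i y := by
  simp [toExt, gen, symLift_symMk]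

theorem toExt_c : b.toExt c = 1 := by
  rw [c, toExt_gen, b.extGen_even Even.zero, map_one]

theorem toExt_ξ (a : Fin n) :
    b.toExt (vec k _ (b.ξ a)) = ExteriorAlgebra.ι k (Pi.single a 1) := by
  rw [vec, LinearMap.comp_apply, toExt_gen, b.extGen_odd (b.odd_deg a)]
  congr 1
  funext a'
  simp [b.form_x_ξ, Pi.single_apply]

/-- The determinant detects the top exterior product of the standard basis. -/
theorem toExt_top_ne_zero : b.toExt b.top ≠ 0 := by
  intro h
  have h1 : ((exteriorPower.ιMulti k n fun a : Fin n => (Pi.single a 1 : Fin n → k)) :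
      ExteriorAlgebra k (Fin n → k)) = 0 := by
    rw [← h, exteriorPower.ιMulti_apply_coe, ExteriorAlgebra.ιMulti_apply, List.ofFn_eq_map,
      top, word, map_mul, map_list_prod, map_list_prod, List.map_map, List.map_map]
    simp [Function.comp_def, toExt_ξ]
  have h2 := congrArg (exteriorPower.alternatingMapLinearEquiv (Pi.basisFun k (Fin n)).det)
    (Subtype.ext h1 : _ = (0 : ⋀[k]^n (Fin n → k)))
  rw [exteriorPower.alternatingMapLinearEquiv_apply_ιMulti, map_zero] at h2
  have h3 := (Pi.basisFun k (Fin n)).det_self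
  rw [show ((Pi.basisFun k (Fin n)) : Fin n → Fin n → k) = fun a => Pi.single a 1 from
    funext fun a => Pi.basisFun_apply k (Fin n) a] at h3
  exact one_ne_zero (h3.symm.trans h2)

theorem top_mem : b.top ∈ symDeg k (HeisSpace k V) (∑ a, b.deg a) := by
  have h := b.word_mem [] (List.finRange n)
  rwa [wordDeg, ← List.ofFn_eq_map, List.sum_ofFn, List.map_nil, List.sum_nil, zero_add] at h

theorem bivector_mul_mem {d : ℤ} {s : GSym k (HeisSpace k V)}
    (hs : s ∈ symDeg k (HeisSpace k V) (d + 1)) :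
    b.bivector * s ∈ symDeg k (HeisSpace k V) d := by
  rw [bivector, Finset.sum_mul]
  refine Submodule.sum_mem _ fun a _ => ?_
  rw [mul_assoc]
  exact gen_mul_mem _ (vec_mul_mem _ hs) (by ring)

/-- The multiplication by `∑ x_a ξ_a`, from degree `d + 1` to degree `d`. -/
def bivectorMul (d : ℤ) :
    symDeg k (HeisSpace k V) (d + 1) →ₗ[k] symDeg k (HeisSpace k V) d :=
  (LinearMap.mulLeft k b.bivector).restrict fun _ hs => b.bivector_mul_mem hs

end DarbouxBasis

/-! ### The linear quantization as a quotient of the symmetric algebra -/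

variable (ω) in
/-- The projection from the degree `d` part of `Sym(V ⊕ k c)` onto the linear quantization. -/
def proj (d : ℤ) : symDeg k (HeisSpace k V) d →ₗ[k] ω.QuantDeg d :=
  (evalSub k V d).mkQ.restrictScalars k ∘ₗ TensorProduct.mk k k[X] _ 1

theorem proj_apply (d : ℤ) (s : symDeg k (HeisSpace k V) d) :
    ω.proj d s = Submodule.Quotient.mk (1 ⊗ₜ s) := rfl

theorem X_smul {d : ℤ} (q : ω.QuantDeg d) : (Polynomial.X : k[X]) • q = q := by
  obtain ⟨t, rfl⟩ := Submodule.Quotient.mk_surjective _ q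
  rw [← Submodule.Quotient.mk_smul, Submodule.Quotient.eq]
  refine Submodule.mem_sup_left ⟨t, ?_⟩
  simp [sub_smul]

theorem poly_smul {d : ℤ} (p : k[X]) (q : ω.QuantDeg d) : p • q = p.eval 1 • q := by
  induction p using Polynomial.induction_on with
  | C a => rw [Polynomial.eval_C, ← Polynomial.algebraMap_eq, algebraMap_smul]
  | add p p' hp hp' => rw [add_smul, hp, hp', Polynomial.eval_add, add_smul]
  | monomial m a h =>
    rw [pow_succ, ← mul_assoc, mul_smul, X_smul, h]
    simp

theorem proj_surjective (d : ℤ) : Function.Surjective (ω.proj d) := by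
  intro q
  obtain ⟨t, rfl⟩ := Submodule.Quotient.mk_surjective _ q
  induction t using TensorProduct.induction_on with
  | zero => exact ⟨0, map_zero _⟩
  | tmul p s =>
    refine ⟨p.eval 1 • s, ?_⟩
    rw [map_smul, proj_apply, ← poly_smul, ← Submodule.Quotient.mk_smul, TensorProduct.smul_tmul',
      smul_eq_mul, mul_one]
  | add t t' h h' =>
    obtain ⟨s, hs⟩ := h
    obtain ⟨s', hs'⟩ := h'
    exact ⟨s + s', by rw [map_add, hs, hs', Submodule.Quotient.mk_add]⟩

theorem proj_cMul {d : ℤ} (s : symDeg k (HeisSpace k V) d) : ω.proj d (cMul d s) = ω.proj d s := by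
  rw [proj_apply, proj_apply, Submodule.Quotient.eq]
  refine Submodule.mem_sup_right ⟨1 ⊗ₜ s, ?_⟩
  rw [LinearMap.baseChange_tmul, ← TensorProduct.tmul_sub]
  rfl

theorem quantDiff_proj {d : ℤ} (s : symDeg k (HeisSpace k V) d) :
    ω.quantDiff d (ω.proj d s) = ω.proj (d + 1) (ω.heis.bvDeg d s) := by
  rw [← X_smul (ω.proj (d + 1) _)]
  rfl

variable (ω) in
/-- The map of linear quantizations in single degrees induced by a map on symmetric algebras that
commutes with `c`. -/
def quantMap {d e : ℤ} (f : symDeg k (HeisSpace k V) d →ₗ[k] symDeg k (HeisSpace k V) e)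
    (hf : f ∘ₗ cMul d = cMul e ∘ₗ f) : ω.QuantDeg d →ₗ[k] ω.QuantDeg e :=
  ((evalSub k V d).mapQ (evalSub k V e) (f.baseChange k[X]) (by
    refine sup_le ?_ ?_
    · rintro _ ⟨t, rfl⟩
      exact Submodule.mem_sup_left ⟨f.baseChange k[X] t, by simp⟩
    · rintro _ ⟨t, rfl⟩
      refine Submodule.mem_sup_right ⟨f.baseChange k[X] t, ?_⟩
      have : f ∘ₗ (cMul d - LinearMap.id) = (cMul e - LinearMap.id) ∘ₗ f := by
        rw [LinearMap.comp_sub, LinearMap.sub_comp, hf]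
        rfl
      have h2 := congrArg (fun g => (g.baseChange k[X]) t) this
      simpa only [LinearMap.baseChange_comp, LinearMap.comp_apply] using h2.symm)).restrictScalars k

theorem quantMap_proj {d e : ℤ}
    (f : symDeg k (HeisSpace k V) d →ₗ[k] symDeg k (HeisSpace k V) e)
    (hf : f ∘ₗ cMul d = cMul e ∘ₗ f) (s : symDeg k (HeisSpace k V) d) :
    ω.quantMap f hf (ω.proj d s) = ω.proj e (f s) := rfl

/-- A linear map on `Sym(V ⊕ k c)` that is invariant under the multiplication by `c` factors through
the linear quantization. -/
theorem map_eq_zero_of_proj_eq_zero {d : ℤ} {M : Type*} [AddCommGroup M] [Module k M]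
    (f : symDeg k (HeisSpace k V) d →ₗ[k] M) (hf : ∀ s, f (cMul d s) = f s)
    {s : symDeg k (HeisSpace k V) d} (hs : ω.proj d s = 0) : f s = 0 := by
  let F : k[X] ⊗[k] symDeg k (HeisSpace k V) d →ₗ[k] M :=
    TensorProduct.lift ((LinearMap.lsmul k M ∘ₗ Polynomial.leval 1).compl₂ f)
  have hF (p : k[X]) (s : symDeg k (HeisSpace k V) d) : F (p ⊗ₜ s) = p.eval 1 • f s := by
    simp [F]
  have key : (evalSub k V d).restrictScalars k ≤ LinearMap.ker F := by
    intro t ht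
    obtain ⟨_, ⟨t1, rfl⟩, _, ⟨t2, rfl⟩, rfl⟩ := Submodule.mem_sup.1 ht
    clear ht
    rw [LinearMap.mem_ker, map_add]
    have h1 : F (((Polynomial.X - 1 : k[X]) • (LinearMap.id : _ →ₗ[k[X]] _)) t1) = 0 := by
      induction t1 using TensorProduct.induction_on with
      | zero => simp
      | tmul p s =>
        rw [LinearMap.smul_apply, LinearMap.id_apply, TensorProduct.smul_tmul', hF]
        simp
      | add t t' h h' => rw [map_add, map_add, h, h', add_zero]
    have h2 : F ((cMul d - LinearMap.id).baseChange k[X] t2) = 0 := by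
      induction t2 using TensorProduct.induction_on with
      | zero => simp
      | tmul p s =>
        rw [LinearMap.baseChange_tmul, hF, LinearMap.sub_apply, map_sub, hf]
        simp
      | add t t' h h' => rw [map_add, map_add, h, h', add_zero]
    rw [h1, h2, add_zero]
  have h := key ((Submodule.Quotient.mk_eq_zero (evalSub k V d)).1 hs)
  rw [LinearMap.mem_ker, TensorProduct.mk_apply, hF] at h
  simpa using h

namespace DarbouxBasis

variable {n : ℕ} (b : ω.DarbouxBasis n)

/-- The multiplication by `∑ x_a ξ_a` on the linear quantization, from degree `d + 1` to degree
`d`. It is a homotopy between zero and the operator `weightOp`. -/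
def homotopy (d : ℤ) : ω.QuantDeg (d + 1) →ₗ[k] ω.QuantDeg d :=
  ω.quantMap (b.bivectorMul d) (by
    refine LinearMap.ext fun s => Subtype.ext ?_
    change b.bivector * (c * s.1) = c * (b.bivector * s.1)
    rw [← mul_assoc, ← c_mul_comm, mul_assoc])

/-- The anticommutator of the differential with the homotopy, in degree `d + 1`. -/
def weightOp (d : ℤ) : Module.End k (ω.QuantDeg (d + 1)) :=
  ω.quantDiff d ∘ₗ b.homotopy d + b.homotopy (d + 1) ∘ₗ ω.quantDiff (d + 1)

theorem quantDiff_quantDiff_apply (d : ℤ) (q : ω.QuantDeg d) :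
    ω.quantDiff (d + 1) (ω.quantDiff d q) = 0 :=
  LinearMap.congr_fun (ω.quantDiff_quantDiff d) q

theorem weightOp_of_cocycle {d : ℤ} {q : ω.QuantDeg (d + 1)} (hq : ω.quantDiff (d + 1) q = 0) :
    b.weightOp d q = ω.quantDiff d (b.homotopy d q) := by
  rw [weightOp, LinearMap.add_apply, LinearMap.comp_apply, LinearMap.comp_apply, hq, map_zero,
    add_zero]

theorem weightOp_quantDiff {d : ℤ} (q : ω.QuantDeg (d + 1)) :
    b.weightOp (d + 1) (ω.quantDiff (d + 1) q) = ω.quantDiff (d + 1) (b.weightOp d q) := by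
  rw [weightOp_of_cocycle _ (quantDiff_quantDiff_apply _ _), weightOp, LinearMap.add_apply,
    map_add, LinearMap.comp_apply, LinearMap.comp_apply, quantDiff_quantDiff_apply, zero_add]

theorem weightOp_word {d : ℤ} (e : List (Σ i : {i : ℤ // Even i}, V i)) (o : List (Fin n))
    (h : b.word e o ∈ symDeg k (HeisSpace k V) (d + 1)) :
    b.weightOp d (ω.proj _ ⟨b.word e o, h⟩) =
      (((n + e.length - o.length : ℤ) : k)) • ω.proj _ ⟨b.word e o, h⟩ := by
  conv_rhs => rw [← proj_cMul, ← map_smul]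
  rw [weightOp, LinearMap.add_apply, LinearMap.comp_apply, LinearMap.comp_apply, homotopy,
    homotopy, quantMap_proj, quantDiff_proj, quantDiff_proj, quantMap_proj, ← map_add]
  congr 1
  exact Subtype.ext (b.bv_bivector_mul_word e o)

/-- The span of the monomials of degree `d`, plus the multiples of `c - 1`. -/
def wordSpan (d : ℤ) : Submodule k (GSym k (HeisSpace k V)) :=
  Submodule.span k {s | ∃ e o, b.wordDeg e o = d ∧ s = b.word e o} ⊔
    (symDeg k (HeisSpace k V) d).map (LinearMap.mulLeft k c - LinearMap.id)

theorem word_mem_wordSpan {d : ℤ} (e : List (Σ i : {i : ℤ // Even i}, V i)) (o : List (Fin n))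
    (h : b.wordDeg e o = d) : b.word e o ∈ b.wordSpan d :=
  Submodule.mem_sup_left (Submodule.subset_span ⟨e, o, h, rfl⟩)

theorem vec_mul_word_mem {i d : ℤ} (y : V i) (e : List (Σ i : {i : ℤ // Even i}, V i))
    (o : List (Fin n)) (h : b.wordDeg e o = d) : vec k i y * b.word e o ∈ b.wordSpan (i + d) := by
  rcases Int.even_or_odd i with hi | hi
  · rw [show vec k i y * b.word e o = b.word (⟨⟨i, hi⟩, y⟩ :: e) o from
      (b.word_cons_left ⟨⟨i, hi⟩, y⟩ e o).symm]
    exact b.word_mem_wordSpan _ _ (by rw [wordDeg_cons_left, h])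
  · rw [← b.sum_odd_vec hi, Finset.sum_mul]
    refine Submodule.sum_mem _ fun a _ => ?_
    by_cases ha : -1 - b.deg a + i = -1
    · rw [smul_mul_assoc, ← word_cons_right]
      exact Submodule.smul_mem _ _ (b.word_mem_wordSpan _ _ (by rw [wordDeg_cons_right]; omega))
    · rw [ω.degree _ _ ha]
      simp

theorem gen_mul_mem_wordSpan {i d : ℤ} (x : HeisSpace k V i) {s : GSym k (HeisSpace k V)}
    (hs : s ∈ b.wordSpan d) : gen k i x * s ∈ b.wordSpan (i + d) := by
  obtain ⟨s, hw, _, ⟨r, hr, rfl⟩, rfl⟩ := Submodule.mem_sup.1 hs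
  clear hs
  rw [mul_add]
  refine add_mem ?_ (Submodule.mem_sup_right ⟨gen k i x * r, gen_mul_mem x hr rfl, ?_⟩)
  · induction hw using Submodule.span_induction with
    | mem s hs =>
      obtain ⟨e, o, h, rfl⟩ := hs
      rw [gen_eq, add_mul]
      refine add_mem (b.vec_mul_word_mem _ e o h) ?_
      by_cases hi : i = 0
      · subst hi
        rw [smul_mul_assoc, zero_add, ← sub_add_cancel (c * b.word e o) (b.word e o)]
        refine Submodule.smul_mem _ _ (add_mem (Submodule.mem_sup_right ?_)
          (b.word_mem_wordSpan e o h))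
        exact ⟨b.word e o, h ▸ b.word_mem e o, rfl⟩
      · rw [x.2.2 hi, zero_smul, zero_mul]
        exact zero_mem _
    | zero => simp
    | add s s' _ _ h h' => rw [mul_add]; exact add_mem h h'
    | smul t s _ h => rw [mul_smul_comm]; exact Submodule.smul_mem _ _ h
  · simp only [LinearMap.sub_apply, LinearMap.mulLeft_apply, LinearMap.id_apply, mul_sub]
    rw [← mul_assoc, c_mul_comm, ← mul_assoc]

theorem symDeg_le_wordSpan (d : ℤ) : symDeg k (HeisSpace k V) d ≤ b.wordSpan d := by
  intro s hs
  refine ShiftedLie.symDeg_induct (P := fun d s => s ∈ b.wordSpan d) ?_ ?_ ?_ ?_ ?_ hs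
  · exact (by simp [word] : b.word [] [] = 1) ▸ b.word_mem_wordSpan [] [] (by simp [wordDeg])
  · intro d i x s _ h
    exact b.gen_mul_mem_wordSpan x h
  · exact zero_mem _
  · exact fun _ _ => add_mem
  · exact fun t _ => Submodule.smul_mem _ t

/-- The linear quantization is spanned by the classes of monomials. -/
theorem eq_top_of_word_mem {d : ℤ} (P : Submodule k (ω.QuantDeg d))
    (hP : ∀ (e : List (Σ i : {i : ℤ // Even i}, V i)) (o : List (Fin n)),
      b.wordDeg e o = d → ∀ h, ω.proj d ⟨b.word e o, h⟩ ∈ P) : P = ⊤ := by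
  have key : symDeg k (HeisSpace k V) d ≤ (P.comap (ω.proj d)).map (Submodule.subtype _) := by
    refine (b.symDeg_le_wordSpan d).trans (sup_le (Submodule.span_le.2 ?_) ?_)
    · rintro _ ⟨e, o, rfl, rfl⟩
      exact ⟨⟨_, b.word_mem e o⟩, hP e o rfl _, rfl⟩
    · rintro _ ⟨s, hs, rfl⟩
      refine ⟨cMul d ⟨s, hs⟩ - ⟨s, hs⟩, ?_, rfl⟩
      rw [SetLike.mem_coe, Submodule.mem_comap, map_sub, proj_cMul, sub_self]
      exact zero_mem _
  rw [eq_top_iff]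
  rintro q -
  obtain ⟨⟨s, hs⟩, rfl⟩ := ω.proj_surjective d q
  obtain ⟨s', hs', h⟩ := key hs
  obtain rfl : s' = ⟨s, hs⟩ := Subtype.ext h
  exact hs'

/-! ### The cohomology of the linear quantization -/

/-- The sum of the eigenspaces of the weight operator with nonzero eigenvalue. -/
def nonzeroWeight (d : ℤ) : Submodule k (ω.QuantDeg (d + 1)) :=
  ⨆ w : k, ⨆ (_ : w ≠ 0), (b.weightOp d).eigenspace w

theorem word_mem_nonzeroWeight [CharZero k] {d : ℤ} (e : List (Σ i : {i : ℤ // Even i}, V i))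
    (o : List (Fin n)) (h : b.word e o ∈ symDeg k (HeisSpace k V) (d + 1))
    (hw : (n + e.length - o.length : ℤ) ≠ 0) :
    ω.proj _ ⟨b.word e o, h⟩ ∈ b.nonzeroWeight d :=
  Submodule.mem_iSup_of_mem ((n + e.length - o.length : ℤ) : k)
    (Submodule.mem_iSup_of_mem (Int.cast_ne_zero.2 hw)
      (Module.End.mem_eigenspace_iff.2 (b.weightOp_word e o h)))

theorem nonzeroWeight_eq_top [CharZero k] {d : ℤ} (hd : d + 1 ≠ ∑ a, b.deg a) :
    b.nonzeroWeight d = ⊤ := by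
  refine b.eq_top_of_word_mem _ fun e o h hm => ?_
  by_cases hw : (n + e.length - o.length : ℤ) = 0
  · rcases b.word_of_weight_eq_zero e o hw with h0 | ⟨h1, -⟩
    · have : (⟨b.word e o, hm⟩ : symDeg k (HeisSpace k V) (d + 1)) = 0 := Subtype.ext h0
      rw [this, map_zero]
      exact zero_mem _
    · exact absurd (h.symm.trans h1) hd
  · exact b.word_mem_nonzeroWeight e o hm hw

theorem nonzeroWeight_sup_span_top [CharZero k] {d : ℤ}
    (ht : b.top ∈ symDeg k (HeisSpace k V) (d + 1)) :
    b.nonzeroWeight d ⊔ Submodule.span k {ω.proj _ ⟨b.top, ht⟩} = ⊤ := by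
  refine b.eq_top_of_word_mem _ fun e o h hm => ?_
  by_cases hw : (n + e.length - o.length : ℤ) = 0
  · refine Submodule.mem_sup_right (Submodule.mem_span_singleton.2 ?_)
    rcases b.word_of_weight_eq_zero e o hw with h0 | ⟨-, t, h1⟩
    · refine ⟨0, ?_⟩
      rw [zero_smul, ← map_zero (ω.proj _)]
      exact congrArg _ (Subtype.ext h0.symm)
    · refine ⟨t, ?_⟩
      rw [← map_smul]
      exact congrArg _ (Subtype.ext h1.symm)
  · exact Submodule.mem_sup_left (b.word_mem_nonzeroWeight e o hm hw)

theorem weightOp_top {d : ℤ} (ht : b.top ∈ symDeg k (HeisSpace k V) (d + 1)) :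
    b.weightOp d (ω.proj _ ⟨b.top, ht⟩) = 0 := by
  have := b.weightOp_word [] (List.finRange n) ht
  simpa [top] using this

theorem quantDiff_top {d : ℤ} (ht : b.top ∈ symDeg k (HeisSpace k V) d) :
    ω.quantDiff d (ω.proj d ⟨b.top, ht⟩) = 0 := by
  -- Odd vectors pair to zero with odd vectors, so no brackets between the `ξ_a` appear.
  have had (a : Fin n) (o : List (Fin n)) : ω.adVec _ (b.ξ a) (b.word [] o) = 0 := by
    induction o with
    | nil => simp [word, ShiftedLie.ad_one]
    | cons a' o ih =>
      rw [word_cons_right, adVec_vec_mul, form_odd_odd (b.odd_deg a) (b.odd_deg a'), ih]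
      simp
  have hbv (o : List (Fin n)) : ω.heis.bv (b.word [] o) = 0 := by
    induction o with
    | nil => simp [word, ShiftedLie.bv_one]
    | cons a o ih => rw [word_cons_right, bv_vec_mul, ih, had]; simp
  rw [quantDiff_proj, ← map_zero (ω.proj (d + 1))]
  exact congrArg _ (Subtype.ext (hbv _))

theorem proj_top_ne_zero {d : ℤ} (ht : b.top ∈ symDeg k (HeisSpace k V) d) :
    ω.proj d ⟨b.top, ht⟩ ≠ 0 := by
  intro h
  refine b.toExt_top_ne_zero (map_eq_zero_of_proj_eq_zero
    (b.toExt.toLinearMap ∘ₗ Submodule.subtype _) (fun s => ?_) h)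
  change b.toExt (c * s.1) = b.toExt s.1
  rw [map_mul, toExt_c, one_mul]

theorem mem_range_of_mem_nonzeroWeight {d : ℤ} {q : ω.QuantDeg (d + 1)}
    (hq : ω.quantDiff (d + 1) q = 0) (hw : q ∈ b.nonzeroWeight d) :
    q ∈ LinearMap.range (ω.quantDiff d) := by
  refine mem_of_map_mem_of_mem_iSup_eigenspace (b.weightOp d) ?_ ?_ hw
  · rintro _ ⟨y, rfl⟩
    exact ⟨_, (b.weightOp_of_cocycle (quantDiff_quantDiff_apply _ _)).symm⟩
  · exact ⟨_, (b.weightOp_of_cocycle hq).symm⟩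

/-- The top monomial is not a coboundary: its weight is zero, while all the weights in the degree
below are nonzero. -/
theorem proj_top_notMem_range [CharZero k] {d : ℤ} (hd : d + 1 = ∑ a, b.deg a)
    (ht : b.top ∈ symDeg k (HeisSpace k V) (d + 1)) :
    ω.proj _ ⟨b.top, ht⟩ ∉ LinearMap.range (ω.quantDiff d) := by
  obtain ⟨d, rfl⟩ : ∃ l, d = l + 1 := ⟨d - 1, by ring⟩
  rintro ⟨y, hy⟩
  have hy1 : y ∈ b.nonzeroWeight d := by
    rw [b.nonzeroWeight_eq_top (by omega)]
    trivial
  have hy2 : ω.quantDiff (d + 1) y ∈ b.nonzeroWeight (d + 1) := by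
    have := Submodule.mem_map_of_mem (f := ω.quantDiff (d + 1)) hy1
    simp only [nonzeroWeight, Submodule.map_iSup] at this
    refine SetLike.le_def.1 (iSup₂_mono fun w _ => ?_) this
    rintro _ ⟨q, hq, rfl⟩
    rw [SetLike.mem_coe, Module.End.mem_eigenspace_iff] at hq
    rw [Module.End.mem_eigenspace_iff, weightOp_quantDiff, hq, map_smul]
  rw [hy] at hy2
  have h := mem_of_map_mem_of_mem_iSup_eigenspace (b.weightOp (d + 1)) (B := ⊥) bot_le
    (by rw [b.weightOp_top ht]; exact zero_mem _) hy2
  exact b.proj_top_ne_zero ht h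

/-- Every cocycle in the degree of the top monomial is cohomologous to a multiple of it. -/
theorem exists_sub_mem_range [CharZero k] {d : ℤ}
    (ht : b.top ∈ symDeg k (HeisSpace k V) (d + 1)) {z : ω.QuantDeg (d + 1)}
    (hz : ω.quantDiff (d + 1) z = 0) :
    ∃ t : k, z - t • ω.proj _ ⟨b.top, ht⟩ ∈ LinearMap.range (ω.quantDiff d) := by
  obtain ⟨y, hy, _, hs, rfl⟩ := Submodule.mem_sup.1
    (show z ∈ b.nonzeroWeight d ⊔ Submodule.span k {ω.proj _ ⟨b.top, ht⟩} by
      rw [b.nonzeroWeight_sup_span_top ht]; trivial)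
  obtain ⟨t, rfl⟩ := Submodule.mem_span_singleton.1 hs
  refine ⟨t, ?_⟩
  rw [add_sub_cancel_right]
  rw [map_add, map_smul, quantDiff_top, smul_zero, add_zero] at hz
  exact b.mem_range_of_mem_nonzeroWeight hz hy

theorem quantization_d (d : ℤ) :
    ω.quantization.d d (d + 1) = ModuleCat.ofHom (ω.quantDiff d) :=
  CochainComplex.of_d (fun d => ModuleCat.of k (ω.QuantDeg d))
    (fun d => ModuleCat.ofHom (ω.quantDiff d)) d

theorem exactAt_quantization [CharZero k] {d : ℤ} (hd : d ≠ ∑ a, b.deg a) :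
    ω.quantization.ExactAt d := by
  obtain ⟨d, rfl⟩ : ∃ l, d = l + 1 := ⟨d - 1, by ring⟩
  rw [HomologicalComplex.exactAt_iff' _ d (d + 1) (d + 1 + 1) (by simp) (by simp),
    CategoryTheory.ShortComplex.moduleCat_exact_iff]
  intro q hq
  have hq' : ω.quantDiff (d + 1) q = 0 := by
    have h := congr($(quantization_d (ω := ω) (d + 1)).hom q)
    exact h.symm.trans hq
  obtain ⟨y, hy⟩ := b.mem_range_of_mem_nonzeroWeight hq'
    (by rw [b.nonzeroWeight_eq_top hd]; trivial)
  exact ⟨y, congr($(quantization_d (ω := ω) d).hom y).trans hy⟩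

/-- The cohomology of the linear quantization is the line spanned by the product of the odd basis
vectors. -/
theorem exists_quasiIso [CharZero k] (L : ModuleCat.{max u v} k) (eL : L ≃ₗ[k] k) :
    Nonempty (L ≅ ω.quantization.homology (∑ a, b.deg a)) ∧
      ∃ f : (HomologicalComplex.single (ModuleCat k) (ComplexShape.up ℤ)
        (∑ a, b.deg a)).obj L ⟶ ω.quantization, QuasiIso f := by
  have ht := b.top_mem
  have hex := fun d => b.exactAt_quantization (d := d)
  obtain ⟨d, hd⟩ : ∃ d, d + 1 = ∑ a, b.deg a := ⟨_, sub_add_cancel _ 1⟩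
  rw [← hd] at ht hex ⊢
  let φ : L →ₗ[k] ω.QuantDeg (d + 1) :=
    LinearMap.toSpanSingleton k _ (ω.proj _ ⟨b.top, ht⟩) ∘ₗ eL.toLinearMap
  refine exists_quasiIso_from_single ω.quantization rfl L hex (ModuleCat.ofHom φ) ?_ ?_ ?_
  · rw [quantization_d]
    refine ModuleCat.hom_ext (LinearMap.ext fun x => ?_)
    change ω.quantDiff (d + 1) (eL x • ω.proj _ ⟨b.top, ht⟩) = 0
    rw [map_smul, quantDiff_top, smul_zero]
  · intro x hx
    rw [quantization_d] at hx
    by_contra hne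
    refine b.proj_top_notMem_range hd ht ?_
    have hx' : eL x • ω.proj _ ⟨b.top, ht⟩ ∈ LinearMap.range (ω.quantDiff d) := hx
    exact (Submodule.smul_mem_iff _ (by simpa using hne)).1 hx'
  · intro z hz
    rw [quantization_d] at hz ⊢
    obtain ⟨t, h⟩ := b.exists_sub_mem_range ht (z := z) hz
    refine ⟨eL.symm t, ?_⟩
    rw [← eL.apply_symm_apply t] at h
    exact h

end DarbouxBasis
end ShiftedPairing
end Quad

/-! ### Existence of Darboux bases -/

section Existence

variable {k : Type u} [Field k] {V : ℤ → Type v} [∀ i, AddCommGroup (V i)] [∀ i, Module k (V i)]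

namespace ShiftedPairing

variable {ω : ShiftedPairing k V}

/-- Finite-dimensionality turns non-degeneracy in the first variable into non-degeneracy in the
second one. -/
theorem Nondegenerate.bijective_flip (hω : ω.Nondegenerate) [∀ i, FiniteDimensional k (V i)]
    (i : ℤ) : Function.Bijective (ω.form i (-1 - i)).flip :=
  (LinearMap.IsPerfPair.of_bijective _ (hω i)).bijective_right

variable [∀ i, FiniteDimensional k (V i)]

/-- The indices of a basis of the part of `V` in the odd degrees `2 n + 1` with `n` in `T`. -/
abbrev OddIndex (k : Type u) [Field k] (V : ℤ → Type v) [∀ i, AddCommGroup (V i)]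
    [∀ i, Module k (V i)] (T : Finset ℤ) : Type :=
  Σ n : T, Fin (Module.finrank k (V (2 * n + 1)))

/-- A non-degenerate pairing has a Darboux basis: any homogeneous basis of the odd part of `V`
together with the dual basis of the even part. -/
theorem Nondegenerate.exists_darbouxBasis (hω : ω.Nondegenerate) (T : Finset ℤ)
    (hT : ∀ n ∉ T, Subsingleton (V (2 * n + 1))) :
    ∃ b : ω.DarbouxBasis (Fintype.card (OddIndex k V T)),
      ∑ a, b.deg a = ∑ n ∈ T, (2 * n + 1) * (Module.finrank k (V (2 * n + 1)) : ℤ) := by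
  -- A basis of each odd piece, and in the complementary even degree its dual basis `x` up to sign.
  let B (n : ℤ) := Module.finBasis k (V (2 * n + 1))
  have hx (a : OddIndex k V T) : ∃ x : V (-1 - (2 * a.1 + 1)),
      (ω.form (2 * a.1 + 1) (-1 - (2 * a.1 + 1))).flip x = -(B a.1).coord a.2 :=
    (hω.bijective_flip _).2 _
  choose x hx using hx
  -- The sign makes `x` dual to the basis when it stands in the first slot of the pairing.
  have hx' (a : OddIndex k V T) (y : V (2 * a.1 + 1)) :
      ω.form _ _ y (x a) = -(B a.1).coord a.2 y := LinearMap.congr_fun (hx a) y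
  have hodd (n : ℤ) : Odd (2 * n + 1) := ⟨n, rfl⟩
  have hskew (a : OddIndex k V T) (y : V (2 * a.1 + 1)) :
      ω.form _ _ (x a) y = (B a.1).coord a.2 y := by
    rw [ω.skew, hx', sgn_even ((odd_neg_one.sub_odd (hodd a.1)).mul_right _)]
    ring
  have hdeg (a : OddIndex k V T) (n : ℤ) (h : (a.1 : ℤ) ≠ n) (y : V (2 * n + 1)) :
      ω.form _ _ (x a) y = 0 := by
    rw [ω.degree _ _ (by omega)]
    rfl
  let eqv := (Fintype.equivFin (OddIndex k V T)).symm
  refine ⟨⟨fun a => 2 * (eqv a).1 + 1, fun a => hodd _, fun a => B _ (eqv a).2, fun a => x (eqv a),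
    ?_, ?_, ?_⟩, ?_⟩
  · intro a a'
    have haa : (a = a') = (eqv a = eqv a') := propext eqv.injective.eq_iff.symm
    simp only [haa]
    clear haa
    generalize eqv a = a
    generalize eqv a' = a'
    obtain ⟨n, i⟩ := a
    obtain ⟨n', i'⟩ := a'
    by_cases h : n = n'
    · subst h
      rw [hskew]
      simp [Finsupp.single_apply, eq_comm]
    · rw [hdeg _ _ (fun h' => h (Subtype.ext h')), if_neg]
      exact fun h' => h (congrArg Sigma.fst h')
  · intro i y hi
    obtain ⟨n, rfl⟩ : ∃ n, i = -1 - (2 * n + 1) := by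
      obtain ⟨l, rfl⟩ := hi
      exact ⟨-l - 1, by ring⟩
    rw [eqv.sum_comp (fun a => ω.form (2 * a.1 + 1) _ (B a.1 a.2) y • DirectSum.lof k ℤ V _ (x a)),
      Fintype.sum_sigma]
    by_cases hn : n ∈ T
    · rw [Finset.sum_eq_single_of_mem (⟨n, hn⟩ : T) (Finset.mem_univ _)]
      · simp only [← map_smul]
        rw [← map_sum (DirectSum.lof k ℤ V (-1 - (2 * n + 1))), ← map_neg]
        congr 1
        refine (hω.bijective_flip (2 * n + 1)).1 ((B n).ext fun i => ?_)
        have hx'' (j) : ω.form _ _ (B n i) (x ⟨⟨n, hn⟩, j⟩) = -(B n).coord j (B n i) :=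
          hx' ⟨⟨n, hn⟩, j⟩ (B n i)
        simp [hx'', Finsupp.single_apply]
      · intro n' _ hne
        refine Finset.sum_eq_zero fun i _ => ?_
        rw [ω.degree _ _ fun h => hne (Subtype.ext (by dsimp only at h ⊢; omega))]
        simp
    · have := hT n hn
      have hy : y = 0 := (hω.bijective_flip (2 * n + 1)).1 (Subsingleton.elim _ _)
      simp [hy]
  · intro i y hi
    obtain ⟨n, rfl⟩ := hi
    rw [eqv.sum_comp (fun a => ω.form _ (2 * n + 1) (x a) y • DirectSum.lof k ℤ V _ (B a.1 a.2)),
      Fintype.sum_sigma]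
    by_cases hn : n ∈ T
    · rw [Finset.sum_eq_single_of_mem (⟨n, hn⟩ : T) (Finset.mem_univ _)]
      · simp only [← map_smul]
        rw [← map_sum (DirectSum.lof k ℤ V (2 * n + 1))]
        congr 1
        have hs (j) : ω.form _ _ (x ⟨⟨n, hn⟩, j⟩) y = (B n).coord j y := hskew ⟨⟨n, hn⟩, j⟩ y
        simp only [hs, Module.Basis.coord_apply]
        exact (B n).sum_repr y
      · intro n' _ hne
        refine Finset.sum_eq_zero fun i _ => ?_
        rw [hdeg _ _ (fun h => hne (Subtype.ext h)), zero_smul]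
    · have := hT n hn
      simp [Subsingleton.elim y 0]
  · change ∑ a, (2 * ((eqv a).1 : ℤ) + 1) = _
    rw [eqv.sum_comp (fun a => 2 * (a.1 : ℤ) + 1), Fintype.sum_sigma]
    simp only [Finset.sum_const, Finset.card_univ, Fintype.card_fin, nsmul_eq_mul]
    rw [Finset.sum_coe_sort T
      (fun n : ℤ => (Module.finrank k (V (2 * n + 1)) : ℤ) * (2 * n + 1))]
    exact Finset.sum_congr rfl fun _ _ => mul_comm _ _

end ShiftedPairing

/-! ### Shifted cotangent spaces and determinant lines -/

/-- The pairing of a shifted cotangent space is non-degenerate: in degree `i` it is the direct sum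
of the biduality map of `Vⁱ` and minus the identity of `(V⁻¹⁻ⁱ)*`. -/
theorem cotangentPairing_nondegenerate [∀ i, FiniteDimensional k (V i)] :
    (cotangentPairing k V).Nondegenerate := by
  intro i
  have hcomp (j : ℤ) (hj : j = i) (x : V i)
      (h : DirectSum.component k ℤ V j (DirectSum.lof k ℤ V i x) = 0) : x = 0 := by
    subst hj
    simpa using h
  have hi : -1 - (-1 - i) = i := by ring
  have hinj : Function.Injective ((cotangentPairing k V).form i (-1 - i)) := by
    refine (injective_iff_map_eq_zero _).2 ?_
    rintro ⟨x, f⟩ h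
    have h' (y : V (-1 - i)) (g : Module.Dual k (V (-1 - (-1 - i)))) :
        g (DirectSum.component k ℤ V _ (DirectSum.lof k ℤ V i x)) - f y = 0 := by
      have := LinearMap.congr_fun h ((y, g) : Cotangent k V (-1 - i))
      simpa [cotangentPairing] using this
    refine Prod.ext (hcomp _ hi x ?_) (LinearMap.ext fun y => ?_)
    · exact (Module.forall_dual_apply_eq_zero_iff k _).1 fun g => by simpa using h' 0 g
    · simpa using h' y 0
  refine ⟨hinj, (LinearMap.injective_iff_surjective_of_finrank_eq_finrank ?_).1 hinj⟩
  have hdim : Module.finrank k (V (-1 - (-1 - i))) = Module.finrank k (V i) := by rw [hi]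
  simp only [Subspace.dual_finrank_eq, Module.finrank_prod, hdim, add_comm]

theorem finrank_detLine (M : Type v) [AddCommGroup M] [Module k M] [FiniteDimensional k M] :
    Module.finrank k (DetLine k M) = 1 := by
  rw [exteriorPower.finrank_eq, Nat.choose_self]

/-- A direct sum of finite-dimensional spaces, almost all of which vanish, is finite-dimensional. -/
theorem finiteDimensional_directSum (M : ℤ → Type v) [∀ i, AddCommGroup (M i)]
    [∀ i, Module k (M i)] [∀ i, FiniteDimensional k (M i)] (T : Finset ℤ)
    (hT : ∀ n ∉ T, Subsingleton (M n)) : FiniteDimensional k (⨁ n, M n) := by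
  let F : (∀ n : T, M n) →ₗ[k] ⨁ n, M n :=
    ∑ n : T, DirectSum.lof k ℤ M n ∘ₗ LinearMap.proj n
  refine Module.Finite.of_surjective F fun z => ?_
  induction z using DirectSum.induction_on with
  | zero => exact ⟨0, map_zero F⟩
  | of i x =>
    by_cases hi : i ∈ T
    · refine ⟨Pi.single ⟨i, hi⟩ x, ?_⟩
      simp only [F, LinearMap.sum_apply, LinearMap.comp_apply, LinearMap.proj_apply]
      rw [Finset.sum_eq_single_of_mem (⟨i, hi⟩ : T) (Finset.mem_univ _)]
      · rw [Pi.single_eq_same]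
        rfl
      · intro n _ hn
        rw [Pi.single_eq_of_ne hn, map_zero]
    · have := hT i hi
      refine ⟨0, ?_⟩
      rw [Subsingleton.elim x 0, map_zero, map_zero]
  | add x y hx hy =>
    obtain ⟨x', rfl⟩ := hx
    obtain ⟨y', rfl⟩ := hy
    exact ⟨x' + y', map_add F x' y'⟩

theorem finiteDimensional_oddPart [∀ i, FiniteDimensional k (V i)]
    (hV : ∃ N : ℤ, ∀ n : ℤ, N < |n| → Subsingleton (V n)) : FiniteDimensional k (OddPart V) := by
  obtain ⟨N, hN⟩ := hV
  refine finiteDimensional_directSum _ (Finset.Icc (-(N + 1)) (N + 1)) fun n hn => hN _ ?_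
  rw [Finset.mem_Icc, ← abs_le] at hn
  grind

theorem finiteDimensional_evenPart [∀ i, FiniteDimensional k (V i)]
    (hV : ∃ N : ℤ, ∀ n : ℤ, N < |n| → Subsingleton (V n)) : FiniteDimensional k (EvenPart V) := by
  obtain ⟨N, hN⟩ := hV
  refine finiteDimensional_directSum _ (Finset.Icc (-(N + 1)) (N + 1)) fun n hn => hN _ ?_
  rw [Finset.mem_Icc, ← abs_le] at hn
  grind

/-- The reindexing `n ↦ -n - 1` turns the dimensions of the odd part of a shifted cotangent space
into an Euler characteristic. -/
theorem finsum_cotangent (f : ℤ → ℤ) (N : ℤ) (hf : ∀ n, N < |n| → f n = 0) :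
    ∑ᶠ n : ℤ, (2 * n + 1) * (f (2 * n + 1) + f (-1 - (2 * n + 1))) =
      ∑ᶠ n : ℤ, (2 * n + 1) * (f (2 * n + 1) - f (2 * n)) := by
  have fin (g : ℤ → ℤ) (hg : ∀ n, |n| ≤ |g n| + 1) :
      (Function.support fun n : ℤ => (2 * n + 1) * f (g n)).Finite := by
    refine (Set.finite_Icc (-(N + 1)) (N + 1)).subset fun n hn => abs_le.1 ?_
    by_contra h
    refine hn ?_
    simp only [hf (g n) (by linarith [hg n]), mul_zero]
  have h1 := fin (fun n => 2 * n + 1) fun n => by grind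
  have h2 := fin (fun n => -1 - (2 * n + 1)) fun n => by grind
  have h3 := fin (fun n => 2 * n) fun n => by grind
  simp only [mul_add (2 * _ + 1) (f _), mul_sub]
  rw [finsum_add_distrib h1 h2, finsum_sub_distrib h1 h3, sub_eq_add_neg, ← finsum_neg_distrib]
  congr 1
  rw [← finsum_comp_equiv (Equiv.subLeft (-1 : ℤ))]
  refine finsum_congr fun n => ?_
  rw [Equiv.subLeft_apply, show -1 - (2 * (-1 - n) + 1) = 2 * n by ring]
  ring

end Existence

/-! ### The cohomology of the linear quantization of a bounded space -/

section Bounded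

variable {k : Type u} [Field k] [CharZero k] {V : ℤ → Type v} [∀ i, AddCommGroup (V i)]
  [∀ i, Module k (V i)] [∀ i, FiniteDimensional k (V i)]

/-- The linear quantization of a bounded non-degenerate space has one-dimensional cohomology, in
the degree of the product of a basis of the odd part; over a field, any line can be chosen as a
representative. -/
theorem ShiftedPairing.Nondegenerate.quantization {ω : ShiftedPairing k V} (hω : ω.Nondegenerate)
    (hV : ∃ N : ℤ, ∀ n : ℤ, N < |n| → Subsingleton (V n)) {m : ℤ}
    (hm : m = ∑ᶠ n : ℤ, (2 * n + 1) * (Module.finrank k (V (2 * n + 1)) : ℤ))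
    (L : Type (max u v)) [AddCommGroup L] [Module k L] (hL : Module.finrank k L = 1) :
    Nonempty (ω.quantization.homology m ≃ₗ[k] k) ∧
      (∀ d : ℤ, d ≠ m → Subsingleton (ω.quantization.homology d)) ∧
      ∃ f : (HomologicalComplex.single (ModuleCat k) (ComplexShape.up ℤ) m).obj
        (ModuleCat.of k L) ⟶ ω.quantization, QuasiIso f := by
  obtain ⟨N, hN⟩ := hV
  have hT (n : ℤ) (hn : n ∉ Finset.Icc (-(N + 1)) (N + 1)) : Subsingleton (V (2 * n + 1)) := by
    refine hN _ ?_
    rw [Finset.mem_Icc, ← abs_le] at hn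
    grind
  obtain ⟨b, hb⟩ := hω.exists_darbouxBasis _ hT
  rw [finsum_eq_sum_of_support_subset (s := Finset.Icc (-(N + 1)) (N + 1)), ← hb] at hm
  · subst hm
    obtain ⟨eL⟩ := Module.nonempty_linearEquiv_of_finrank_eq_one hL
    obtain ⟨⟨iso⟩, f⟩ := b.exists_quasiIso (ModuleCat.of k L) eL.symm
    exact ⟨⟨iso.toLinearEquiv.symm.trans eL.symm⟩,
      fun d hd => ModuleCat.subsingleton_of_isZero (b.exactAt_quantization hd).isZero_homology, f⟩
  · intro n hn
    by_contra h
    have := hT n h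
    exact hn (by simp [Module.finrank_zero_of_subsingleton])

end Bounded

end BVQuant
end
theorem mainTheorem6 {k : Type*} [Field k] [CharZero k] :
    (∀ (V : ℤ → Type*) [∀ n, AddCommGroup (V n)] [∀ n, Module k (V n)]
      [∀ n, FiniteDimensional k (V n)],
      (∃ N : ℤ, ∀ n : ℤ, N < |n| → Subsingleton (V n)) →
      ∀ ω : BVQuant.ShiftedPairing k V, ω.Nondegenerate →
      ∀ m : ℤ, m = ∑ᶠ n : ℤ, (2 * n + 1) * (Module.finrank k (V (2 * n + 1)) : ℤ) →
        Nonempty (ω.quantization.homology m ≃ₗ[k] k) ∧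
        (∀ d : ℤ, d ≠ m → Subsingleton (ω.quantization.homology d)) ∧
        ∃ f : (HomologicalComplex.single (ModuleCat k) (ComplexShape.up ℤ) m).obj
            (ModuleCat.of k (BVQuant.DetLine k (BVQuant.OddPart V))) ⟶ ω.quantization,
          QuasiIso f) ∧
    (∀ (W : ℤ → Type*) [∀ n, AddCommGroup (W n)] [∀ n, Module k (W n)]
      [∀ n, FiniteDimensional k (W n)],
      (∃ N : ℤ, ∀ n : ℤ, N < |n| → Subsingleton (W n)) →
      ∀ d : ℤ, d = ∑ᶠ n : ℤ, (2 * n + 1) *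
          ((Module.finrank k (W (2 * n + 1)) : ℤ) - (Module.finrank k (W (2 * n)) : ℤ)) →
        ∃ f : (HomologicalComplex.single (ModuleCat k) (ComplexShape.up ℤ) d).obj
            (ModuleCat.of k (BVQuant.GradedDet k W)) ⟶
              (BVQuant.cotangentPairing k W).quantization,
          QuasiIso f) := by
  constructor
  · intro V _ _ _ hV ω hω m hm
    have := BVQuant.finiteDimensional_oddPart (k := k) hV
    exact hω.quantization hV hm _ (BVQuant.finrank_detLine _)
  · intro W _ _ _ hW d hd
    have := BVQuant.finiteDimensional_oddPart (k := k) hW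
    have := BVQuant.finiteDimensional_evenPart (k := k) hW
    obtain ⟨N, hN⟩ := hW
    refine (BVQuant.cotangentPairing_nondegenerate.quantization ⟨N + 1, fun n hn => ?_⟩ ?_ _ ?_).2.2
    · have := hN n (by linarith)
      have := hN (-1 - n) (by grind)
      infer_instance
    · rw [hd, ← BVQuant.finsum_cotangent (fun n => Module.finrank k (W n)) N fun n hn => ?_]
      · simp [Subspace.dual_finrank_eq]
      · have := hN n hn
        simp [Module.finrank_zero_of_subsingleton]
    · rw [Module.finrank_tensorProduct, Subspace.dual_finrank_eq, BVQuant.finrank_detLine,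
        BVQuant.finrank_detLine]
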